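/- Let $\mathbf T^d$ be the $d$-dimensional torus of unit volume, with the Euclidean torus distance $\big(\sum_{i}\min\{|x_i-y_i|,1-|x_i-y_i|\}^2\big)^{1/2}$. The $d$-NN tree $T_n$ has as vertices $n$ independent uniform points $x_1,\dots,x_n$ of $\mathbf T^d$; for $2\le i\le n$, the vertex $x_i$ is joined to the closest of $x_1,\dots,x_{i-1}$ (ties, which almost surely do not occur, are broken arbitrarily). Its root is $x_1$, and $T_n^\circ$ denotes the unlabeled tree embedded in $\mathbf T^d$, i.e. the set of vertices and the set of edges of $T_n$, without the order of arrival. An embedded root finding procedure maps $T_n^\circ$ to a finite set $H(\varepsilon,n)$ of points of $\mathbf T^d$. (Upper bound) There is an algorithm (a program for a real random access machine with unit-cost operations) and an absolute constant $C>0$ such that for every $d\ge 2$ there is $\varepsilon_d>0$ such that for all $0<\varepsilon<\varepsilon_d$ and all $n\ge 1$ the following holds. Given $\varepsilon$, $d$ and $T_n^\circ$ (the vertices listed in any order with their coordinates, and the edges listed in any order), the algorithm stops after at most $$C\Big(n^2+n\,(1/\varepsilon)^{1/\log\log(1/\varepsilon)}\Big)$$ steps and returns a set $H(\varepsilon,n)$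 of vertices, depending only on $\varepsilon$, $d$ and $T_n^\circ$, with $$|H(\varepsilon,n)|\le \exp\Big(\frac{\log(1/\varepsilon)}{\log\log(1/\varepsilon)}+d\log\log(1/\varepsilon)\Big),$$ and $\mathbf P\{x_1\in H(\varepsilon,n)\}\ge 1-\varepsilon$. (The bounds on the running time and on the size hold for every realization of $T_n$ with distinct vertices.) (Lower bound) There are absolute constants $c>0$ and $\varepsilon_1>0$ such that for all $d\ge 2$, all $0<\varepsilon<\varepsilon_1$ and all $K\in\mathbb N$: if an embedded root finding procedure, computable or not, satisfies $|H(\varepsilon,n)|\le K$ almost surely for all large $n$, and $\liminf_{n\to\infty}\mathbf P\{x_1\in H(\varepsilon,n)\}\ge 1-\varepsilon$, then $$K\log\big(K d^{-1/d}\big)>\frac{c\,\log(1/\varepsilon)}{d},$$ where $0\log 0=0$. -/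

import Mathlib

open Filter MeasureTheory

namespace RootFinding

/-! Nearest neighbour trees on the torus. -/

/-- The `d`-dimensional torus of unit volume; `volume` is the uniform probability measure on it. -/
abbrev Torus (d : ℕ) : Type := UnitAddTorus (Fin d)

/-- The Euclidean torus distance. For `a b : ℝ` in `[0, 1)`, the norm of `a - b` in
`UnitAddCircle` is `min |a - b| (1 - |a - b|)`. (The `dist` that Mathlib puts on the product is the
supremum distance and is not used.) -/
noncomputable def torusDist {d : ℕ} (x y : Torus d) : ℝ :=
  Real.sqrt (∑ i, ‖x i - y i‖ ^ 2)

/-- An unlabeled embedded tree in `X`: the set of its vertices, which are points of `X`, and the set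
of its edges, which are unordered pairs of points. No arrival times are recorded. -/
structure EmbeddedTree (X : Type) where
  verts : Set X
  edges : Set (Sym2 X)

/-- `IsNNTree x T`: `T` is the unlabeled embedded tree of a nearest neighbour tree whose vertices
arrive in the order `x 0, x 1, …, x (n - 1)`. Each vertex `i` other than the root `0` is joined to a
vertex `p i` that is closest to it among the earlier ones, ties being broken arbitrarily. -/
def IsNNTree {d n : ℕ} (x : Fin n → Torus d) (T : EmbeddedTree (Torus d)) : Prop :=
  ∃ p : Fin n → Fin n,
    (∀ i : Fin n, 0 < (i : ℕ) →
      p i < i ∧ ∀ j : Fin n, j < i → torusDist (x i) (x (p i)) ≤ torusDist (x i) (x j)) ∧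
    T.verts = Set.range x ∧
    T.edges = {e | ∃ i : Fin n, 0 < (i : ℕ) ∧ e = s(x i, x (p i))}

/-- A procedure for embedded root finding: it sees the unlabeled embedded tree and nothing else, and
answers with a finite set of points. -/
abbrev Procedure (d : ℕ) : Type := EmbeddedTree (Torus d) → Finset (Torus d)

/-- The event, for `n` independent uniform points `x 0, …, x (n - 1)`, that the root `x 0` is not in
the set returned on the nearest neighbour tree (which is almost surely unique). -/
def missEvent {d : ℕ} (H : Procedure d) (n : ℕ) : Set (Fin n → Torus d) :=
  {x | ∃ T, IsNNTree x T ∧ ¬ ∃ i : Fin n, (i : ℕ) = 0 ∧ x i ∈ H T}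

/-- The probability that the returned set contains the root of the random nearest neighbour tree on
`n` vertices. If the event is not measurable this is its inner probability, i.e. the largest
probability of a measurable event that it contains. -/
noncomputable def successProb {d : ℕ} (H : Procedure d) (n : ℕ) : ℝ :=
  1 - (volume : Measure (Fin n → Torus d)).real (missEvent H n)

/-! A real random access machine, programmed in a structured language. There are arrays of
natural numbers and arrays of real numbers, addressed by natural numbers. The unit-cost operations
are: reading and writing a cell, constants, addition and (truncated) subtraction of naturals, the
four operations of real arithmetic, comparisons, logical connectives, and branching. -/

/-- The memory: `nat a i` and `real a i` are the cells with index `i` of the array `a`. -/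
structure State where
  nat : ℕ → ℕ → ℕ
  real : ℕ → ℕ → ℝ

/-- Expressions with natural values. -/
inductive NExp where
  | const (k : ℕ)
  | read (a : ℕ) (i : NExp)
  | add (e f : NExp)
  | sub (e f : NExp)

/-- Expressions with real values. The constants are natural numbers. -/
inductive RExp where
  | const (k : ℕ)
  | read (a : ℕ) (i : NExp)
  | add (e f : RExp)
  | sub (e f : RExp)
  | mul (e f : RExp)
  | div (e f : RExp)

/-- Tests. -/
inductive BExp where
  | natLt (e f : NExp)
  | natEq (e f : NExp)
  | realLt (e f : RExp)
  | not (b : BExp)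
  | and (b c : BExp)

/-- Programs. -/
inductive Program where
  | skip
  | setNat (a : ℕ) (i e : NExp)
  | setReal (a : ℕ) (i : NExp) (e : RExp)
  | seq (P Q : Program)
  | ite (b : BExp) (P Q : Program)
  | while (b : BExp) (P : Program)

def NExp.eval (s : State) : NExp → ℕ
  | .const k => k
  | .read a i => s.nat a (i.eval s)
  | .add e f => e.eval s + f.eval s
  | .sub e f => e.eval s - f.eval s

noncomputable def RExp.eval (s : State) : RExp → ℝ
  | .const k => k
  | .read a i => s.real a (i.eval s)
  | .add e f => e.eval s + f.eval s
  | .sub e f => e.eval s - f.eval s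
  | .mul e f => e.eval s * f.eval s
  | .div e f => e.eval s / f.eval s

def BExp.Holds (s : State) : BExp → Prop
  | .natLt e f => e.eval s < f.eval s
  | .natEq e f => e.eval s = f.eval s
  | .realLt e f => e.eval s < f.eval s
  | .not b => ¬ b.Holds s
  | .and b c => b.Holds s ∧ c.Holds s

/-- The number of operations made to evaluate an expression. -/
def NExp.cost : NExp → ℕ
  | .const _ => 1
  | .read _ i => 1 + i.cost
  | .add e f => 1 + e.cost + f.cost
  | .sub e f => 1 + e.cost + f.cost

def RExp.cost : RExp → ℕ
  | .const _ => 1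
  | .read _ i => 1 + i.cost
  | .add e f => 1 + e.cost + f.cost
  | .sub e f => 1 + e.cost + f.cost
  | .mul e f => 1 + e.cost + f.cost
  | .div e f => 1 + e.cost + f.cost

def BExp.cost : BExp → ℕ
  | .natLt e f => 1 + e.cost + f.cost
  | .natEq e f => 1 + e.cost + f.cost
  | .realLt e f => 1 + e.cost + f.cost
  | .not b => 1 + b.cost
  | .and b c => 1 + b.cost + c.cost

def State.writeNat (s : State) (a i v : ℕ) : State :=
  { s with nat := Function.update s.nat a (Function.update (s.nat a) i v) }

noncomputable def State.writeReal (s : State) (a i : ℕ) (v : ℝ) : State :=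
  { s with real := Function.update s.real a (Function.update (s.real a) i v) }

/-- `Runs P s t s'`: started in the state `s`, the program `P` halts in the state `s'` after exactly
`t` steps. -/
inductive Runs : Program → State → ℕ → State → Prop where
  | skip (s : State) : Runs .skip s 1 s
  | setNat (s : State) (a : ℕ) (i e : NExp) :
      Runs (.setNat a i e) s (1 + i.cost + e.cost) (s.writeNat a (i.eval s) (e.eval s))
  | setReal (s : State) (a : ℕ) (i : NExp) (e : RExp) :
      Runs (.setReal a i e) s (1 + i.cost + e.cost) (s.writeReal a (i.eval s) (e.eval s))
  | seq {P Q : Program} {s s' s'' : State} {t t' : ℕ} :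
      Runs P s t s' → Runs Q s' t' s'' → Runs (.seq P Q) s (t + t') s''
  | iteTrue {b : BExp} {P Q : Program} {s s' : State} {t : ℕ} :
      b.Holds s → Runs P s t s' → Runs (.ite b P Q) s (1 + b.cost + t) s'
  | iteFalse {b : BExp} {P Q : Program} {s s' : State} {t : ℕ} :
      ¬ b.Holds s → Runs Q s t s' → Runs (.ite b P Q) s (1 + b.cost + t) s'
  | whileTrue {b : BExp} {P : Program} {s s' s'' : State} {t t' : ℕ} :
      b.Holds s → Runs P s t s' → Runs (.while b P) s' t' s'' →
      Runs (.while b P) s (1 + b.cost + t + t') s''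
  | whileFalse {b : BExp} {P : Program} {s : State} :
      ¬ b.Holds s → Runs (.while b P) s (1 + b.cost) s

/-! How a machine is given an unlabeled embedded tree, and how it answers. -/

/-- A listing of an unlabeled embedded tree with `n` vertices: its vertices in any order, without
repetition, and its `n - 1` edges in any order and any orientation, as pairs of positions in the list
of vertices. -/
structure Listing {d : ℕ} (T : EmbeddedTree (Torus d)) (n : ℕ) where
  vert : Fin n → Torus d
  vert_injective : Function.Injective vert
  range_vert : Set.range vert = T.verts
  src : Fin (n - 1) → Fin n
  tgt : Fin (n - 1) → Fin n
  range_edge : Set.range (fun e => s(vert (src e), vert (tgt e))) = T.edges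

/-- The coordinate in `[0, 1)` of a point of the circle. -/
noncomputable def coord (a : UnitAddCircle) : ℝ := (AddCircle.equivIco (1 : ℝ) 0 a : ℝ)

/-- The initial memory for the input `ε`, `d` and a listing of a tree with `n` vertices. The array
`0` of naturals holds `n` and `d`, the arrays `1` and `2` of naturals hold the two ends of the edges;
the array `0` of reals holds `ε`, and in the array `1` of reals the `j`-th coordinate of the `i`-th
listed vertex is at the index `i * d + j`. All other cells are `0`. -/
noncomputable def inputState {d n : ℕ} {T : EmbeddedTree (Torus d)} (ε : ℝ) (L : Listing T n) :
    State where
  nat a i :=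
    if a = 0 then (if i = 0 then n else if i = 1 then d else 0)
    else if a = 1 then (if h : i < n - 1 then (L.src ⟨i, h⟩ : ℕ) else 0)
    else if a = 2 then (if h : i < n - 1 then (L.tgt ⟨i, h⟩ : ℕ) else 0)
    else 0
  real a i :=
    if a = 0 then (if i = 0 then ε else 0)
    else if a = 1 then
      (if h : i < n * d then coord (L.vert (Fin.divNat ⟨i, h⟩) (Fin.modNat ⟨i, h⟩)) else 0)
    else 0

/-- `ReturnsWithin P ε L S τ`: on the input `ε`, `d` and the listing `L`, the program `P` halts after
at most `τ` steps, having marked by a `1`, in the array `3` of naturals, exactly the listed vertices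
that belong to `S`. -/
def ReturnsWithin {d n : ℕ} {T : EmbeddedTree (Torus d)} (P : Program) (ε : ℝ) (L : Listing T n)
    (S : Finset (Torus d)) (τ : ℝ) : Prop :=
  ∃ (t : ℕ) (s : State), Runs P (inputState ε L) t s ∧ (t : ℝ) ≤ τ ∧
    ∀ i : Fin n, s.nat 3 i = 1 ↔ L.vert i ∈ S

end RootFinding

/-! Write `L = log (1/ε)`. Everything rests on one property of nearest neighbour trees: when a
vertex is joined to its parent at distance `ρ`, every earlier vertex is at distance at least `ρ`.
Long edges are therefore few, by packing, while short early edges force an unlikely clustering.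

Upper bound. Let `k` be about `log₂ (1/ε)`, `q` the rounded-up square root of `k`, `m = q + 2`, `r =
2^(-q)`. The procedure starts from the ends of all edges of length at least `r` and walks `m` steps
along edges of length at least `ε`. If the edges of the first `m` vertices are all shorter than `r`,
these vertices lie within `m r` of the root in every coordinate, which has probability at most `(2 m
r)^(d (m - 1))`, roughly `2^(-d q²)`. If two of them are within `ε`, an event of probability at most
`m² (2 ε)^d` occurs. Each term is at most `ε / 2` (`failure_le`). Otherwise some early edge is a
seed, and the path from it to the root stays among the first `m` vertices, so it has fewer than `m`
edges, all of length at least `ε` (`IsNNTree.root_mem_candidates`). The later ends of the seed edges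
are `r`-separated, and the children of one vertex at distances in `[ρ, 2ρ)` are `ρ`-separated. This
bounds the number of seeds and the branching of the walk (`IsNNTree.ncard_seeds_le`,
`IsNNTree.ncard_neighbors_le`). For fixed `d` the size is `exp (O(√L log L))`, eventually below `exp
(L / log L)` (`exists_threshold`). The program needs `O(n (d + k + q + 2))` steps
(`IsNNTree.achieves_candidateProgram`).

Lower bound. Suppose the first `K + 1` vertices are near equally spaced points of a diagonal, in
order, so that they form a path. Let them arrive instead from any position `v`, first upwards and
then downwards: the unlabeled tree is the same, but its root is now at `v`
(`PathLike.isNNTree_comp`). A set of `K` points misses one of these `K + 1` roots, and permuting the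
vertices preserves the measure, so the failure probability is at least that of the configuration
divided by `K + 1` (`volume_le_mul_missEvent`). Taking logarithms gives the inequality for `K ≥ 2`.
For `K ≤ 1` two points at distance at least `1/4` already force failure with probability at least
`1/4`. -/

namespace RootFinding

/-! ### Geometry of the torus -/

lemma coord_nonneg (a : UnitAddCircle) : 0 ≤ coord a :=
  (AddCircle.equivIco (1 : ℝ) 0 a).2.1

lemma coord_lt_one (a : UnitAddCircle) : coord a < 1 := by
  have h := (AddCircle.equivIco (1 : ℝ) 0 a).2.2
  exact h.trans_eq (zero_add 1)

lemma coe_coord (a : UnitAddCircle) : ((coord a : ℝ) : UnitAddCircle) = a :=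
  (AddCircle.equivIco (1 : ℝ) 0).symm_apply_apply a

lemma coord_coe (t : ℝ) : coord (t : UnitAddCircle) = Int.fract t := by
  unfold coord
  rw [AddCircle.coe_equivIco_mk_apply]
  simp

lemma coord_coe_le {t : ℝ} (ht : 0 ≤ t) : coord (t : UnitAddCircle) ≤ t := by
  rw [coord_coe, Int.fract]
  have : (0 : ℤ) ≤ ⌊t⌋ := Int.floor_nonneg.2 ht
  have : (0 : ℝ) ≤ (⌊t⌋ : ℝ) := by exact_mod_cast this
  linarith

lemma norm_coe_le_abs (t : ℝ) : ‖(t : UnitAddCircle)‖ ≤ |t| := by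
  rw [UnitAddCircle.norm_eq]
  simpa using round_le t 0

lemma norm_coe_eq_abs {t : ℝ} (ht : |t| ≤ 1 / 2) : ‖(t : UnitAddCircle)‖ = |t| := by
  rw [AddCircle.norm_coe_eq_abs_iff _ one_ne_zero]
  simpa using ht

lemma norm_sub_le_abs_coord (a b : UnitAddCircle) : ‖a - b‖ ≤ |coord a - coord b| := by
  conv_lhs => rw [← coe_coord a, ← coe_coord b, ← AddCircle.coe_sub]
  exact norm_coe_le_abs _

lemma exists_coe_eq_abs_eq_norm (a : UnitAddCircle) :
    ∃ t : ℝ, (t : UnitAddCircle) = a ∧ |t| = ‖a‖ := by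
  refine ⟨coord a - round (coord a), ?_, ?_⟩
  · rw [AddCircle.coe_sub, coe_coord]
    have : ((round (coord a) : ℝ) : UnitAddCircle) = 0 := by
      rw [AddCircle.coe_eq_zero_iff]
      exact ⟨round (coord a), by simp⟩
    rw [this, sub_zero]
  · conv_rhs => rw [← coe_coord a]
    rw [UnitAddCircle.norm_eq]

lemma norm_sub_eq_min (a b : UnitAddCircle) :
    ‖a - b‖ = min |coord a - coord b| (1 - |coord a - coord b|) := by
  have key : ∀ t : ℝ, 0 ≤ t → t < 1 → ‖(t : UnitAddCircle)‖ = min t (1 - t) := by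
    intro t h0 h1
    rw [UnitAddCircle.norm_eq, abs_sub_round_eq_min, Int.fract_eq_self.2 ⟨h0, h1⟩]
  have ha := coord_nonneg a
  have hb := coord_nonneg b
  have ha' := coord_lt_one a
  have hb' := coord_lt_one b
  have e : a - b = ((coord a - coord b : ℝ) : UnitAddCircle) := by
    rw [AddCircle.coe_sub, coe_coord, coe_coord]
  rcases le_total (coord b) (coord a) with h | h
  · rw [abs_of_nonneg (by linarith), e]
    exact key _ (by linarith) (by linarith)
  · rw [abs_of_nonpos (by linarith), e, ← norm_neg, ← AddCircle.coe_neg]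
    exact key _ (by linarith) (by linarith)

lemma norm_le_half (a : UnitAddCircle) : ‖a‖ ≤ 1 / 2 := by
  simpa using AddCircle.norm_le_half_period (1 : ℝ) (x := a) one_ne_zero

variable {d : ℕ}

lemma torusDist_nonneg (x y : Torus d) : 0 ≤ torusDist x y := Real.sqrt_nonneg _

lemma torusDist_comm (x y : Torus d) : torusDist x y = torusDist y x := by
  unfold torusDist
  simp_rw [norm_sub_rev (x _) (y _)]

lemma torusDist_self (x : Torus d) : torusDist x x = 0 := by simp [torusDist]

lemma torusDist_sq (x y : Torus d) : torusDist x y ^ 2 = ∑ i, ‖x i - y i‖ ^ 2 :=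
  Real.sq_sqrt (Finset.sum_nonneg fun _ _ => sq_nonneg _)

lemma norm_le_torusDist (x y : Torus d) (i : Fin d) : ‖x i - y i‖ ≤ torusDist x y := by
  apply Real.le_sqrt_of_sq_le
  exact Finset.single_le_sum (f := fun i => ‖x i - y i‖ ^ 2) (fun _ _ => sq_nonneg _)
    (Finset.mem_univ i)

lemma torusDist_le_of_norm_le {x y : Torus d} {a : ℝ} (ha : 0 ≤ a)
    (h : ∀ i, ‖x i - y i‖ ≤ a) : torusDist x y ≤ √d * a := by
  apply Real.sqrt_le_iff.2 ⟨by positivity, ?_⟩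
  rw [mul_pow, Real.sq_sqrt (Nat.cast_nonneg d)]
  calc ∑ i, ‖x i - y i‖ ^ 2 ≤ ∑ _i : Fin d, a ^ 2 := by
        gcongr with i; exact h i
    _ = _ := by simp

lemma le_torusDist_of_le_norm {x y : Torus d} {a : ℝ} (ha : 0 ≤ a)
    (h : ∀ i, a ≤ ‖x i - y i‖) : √d * a ≤ torusDist x y := by
  apply Real.le_sqrt_of_sq_le
  rw [mul_pow, Real.sq_sqrt (Nat.cast_nonneg d)]
  calc _ = ∑ _i : Fin d, a ^ 2 := by simp
    _ ≤ ∑ i, ‖x i - y i‖ ^ 2 := by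
        gcongr with i; exact h i

lemma torusDist_le (x y : Torus d) : torusDist x y ≤ d := by
  have h := torusDist_le_of_norm_le (x := x) (y := y) zero_le_one
    (fun i => (norm_le_half _).trans (by norm_num))
  rcases Nat.eq_zero_or_pos d with rfl | hd
  · simpa using h
  · have : √(d : ℝ) ≤ d := by
      apply Real.sqrt_le_iff.2 ⟨by positivity, ?_⟩
      have : (1 : ℝ) ≤ d := by exact_mod_cast hd
      nlinarith
    linarith

/-! ### Packing of separated points by cells -/

/-- The index of the cell, in a partition of the torus into cells of side `w`. -/
noncomputable def cell (w : ℝ) (x : Torus d) (i : Fin d) : ℕ := ⌊coord (x i) / w⌋₊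

lemma torusDist_lt_of_cell_eq {w : ℝ} (hw : 0 < w) (hd : 0 < d) {x y z : Torus d}
    (h : cell w (fun i => x i + z i) = cell w (fun i => y i + z i)) : torusDist x y < d * w := by
  have hc : ∀ i, ‖x i - y i‖ < w := by
    intro i
    have hi := congrFun h i
    unfold cell at hi
    have e : x i - y i = (x i + z i) - (y i + z i) := by abel
    rw [e]
    refine (norm_sub_le_abs_coord _ _).trans_lt ?_
    have h1 := Nat.floor_le (div_nonneg (coord_nonneg (x i + z i)) hw.le)
    have h2 := Nat.lt_floor_add_one (coord (x i + z i) / w)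
    have h3 := Nat.floor_le (div_nonneg (coord_nonneg (y i + z i)) hw.le)
    have h4 := Nat.lt_floor_add_one (coord (y i + z i) / w)
    rw [hi] at h1 h2
    rw [le_div_iff₀ hw] at h1 h3
    rw [div_lt_iff₀ hw] at h2 h4
    rw [abs_lt]
    constructor <;> linarith
  have hd' : (1 : ℝ) ≤ d := by exact_mod_cast hd
  unfold torusDist
  rw [Real.sqrt_lt' (by positivity)]
  have : Nonempty (Fin d) := ⟨⟨0, hd⟩⟩
  calc ∑ i, ‖x i - y i‖ ^ 2 < ∑ _i : Fin d, w ^ 2 := by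
        apply Finset.sum_lt_sum_of_nonempty Finset.univ_nonempty
        intro i _
        exact pow_lt_pow_left₀ (hc i) (norm_nonneg _) two_ne_zero
    _ = d * w ^ 2 := by simp
    _ ≤ _ := by rw [mul_pow]; gcongr; nlinarith

lemma cell_lt_of_forall_le {w : ℝ} (hw : 0 < w) {x : Torus d} {M : ℕ}
    (h : ∀ i, coord (x i) ≤ M * w) (i : Fin d) : cell w x i < M + 1 := by
  unfold cell
  rw [Nat.lt_add_one_iff]
  apply Nat.floor_le_of_le
  rw [div_le_iff₀ hw]
  exact h i

/-- A finite family of points in a set of cells, no two of which are within `d * w`. -/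
lemma card_le_of_separated {ι : Type*} [LinearOrder ι] (hd : 0 < d) {w : ℝ} (hw : 0 < w)
    (x : ι → Torus d) (z : Torus d) (M : ℕ) (A : Finset ι)
    (hM : ∀ a ∈ A, ∀ i, coord (x a i + z i) ≤ M * w)
    (hsep : ∀ a ∈ A, ∀ b ∈ A, a < b → d * w ≤ torusDist (x b) (x a)) :
    A.card ≤ (M + 1) ^ d := by
  classical
  have hcard : (Fintype.piFinset fun _ : Fin d => Finset.range (M + 1)).card = (M + 1) ^ d := by
    simp
  rw [← hcard]
  -- Separation makes the cell map injective. The translation by `z` lets a small cluster be moved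
  -- to the corner of the unit cube, where it meets few cells.
  apply Finset.card_le_card_of_injOn (fun a => cell w (fun i => x a i + z i))
  · intro a ha
    simp only [Finset.mem_coe, Fintype.mem_piFinset, Finset.mem_range]
    exact cell_lt_of_forall_le hw (hM a ha)
  · intro a ha b hb hab
    by_contra hne
    rcases lt_or_gt_of_ne hne with h | h
    · have := torusDist_lt_of_cell_eq hw hd hab
      rw [torusDist_comm] at this
      exact absurd (hsep a ha b hb h) (not_le.2 this)
    · have := torusDist_lt_of_cell_eq hw hd hab
      exact absurd (hsep b hb a ha h) (not_le.2 this)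

/-! ### The confidence set and its size -/

section Candidates

variable {d : ℕ}

/-- The vertices of a set together with their neighbours along edges of length at least `s`. -/
def expand (T : EmbeddedTree (Torus d)) (s : ℝ) (S : Set (Torus d)) : Set (Torus d) :=
  S ∪ {v | ∃ u ∈ S, s(u, v) ∈ T.edges ∧ s ≤ torusDist u v}

/-- The end points of the edges of length at least `r`, and all vertices if there are at
most `m`. -/
def seeds (T : EmbeddedTree (Torus d)) (r : ℝ) (m : ℕ) : Set (Torus d) :=
  {v | T.verts.ncard ≤ m ∧ v ∈ T.verts} ∪ {v | ∃ u, s(u, v) ∈ T.edges ∧ r ≤ torusDist u v}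

/-- The vertices that are joined to a seed by at most `m` edges of length at least `s`. -/
def candidates (T : EmbeddedTree (Torus d)) (s r : ℝ) (m : ℕ) : Set (Torus d) :=
  (expand T s)^[m] (seeds T r m)

open Classical in
/-- The procedure that returns the candidates. -/
noncomputable def candidateProcedure (s r : ℝ) (m : ℕ) : Procedure d := fun T =>
  -- For nearest neighbour trees the set is always finite, so the default value is never used.
  if h : (candidates T s r m).Finite then h.toFinset else ∅

lemma subset_expand (T : EmbeddedTree (Torus d)) (s : ℝ) (S : Set (Torus d)) :
    S ⊆ expand T s S := Set.subset_union_left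

lemma subset_iterate_expand (T : EmbeddedTree (Torus d)) (s : ℝ) (S : Set (Torus d)) (k : ℕ) :
    S ⊆ (expand T s)^[k] S := by
  induction k with
  | zero => exact subset_rfl
  | succ k ih =>
    rw [Function.iterate_succ_apply']
    exact ih.trans (subset_expand _ _ _)

lemma iterate_expand_mono (T : EmbeddedTree (Torus d)) (s : ℝ) (S : Set (Torus d)) {k l : ℕ}
    (hkl : k ≤ l) : (expand T s)^[k] S ⊆ (expand T s)^[l] S := by
  obtain ⟨a, rfl⟩ := Nat.exists_eq_add_of_le' hkl
  rw [Function.iterate_add_apply]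
  exact subset_iterate_expand _ _ _ _

variable {n : ℕ} {x : Fin n → Torus d} {T : EmbeddedTree (Torus d)}

lemma IsNNTree.mem_verts_of_mem_edges (h : IsNNTree x T) {u v : Torus d}
    (he : s(u, v) ∈ T.edges) : v ∈ T.verts := by
  obtain ⟨p, -, hv, hE⟩ := h
  rw [hE] at he
  obtain ⟨i, -, hi⟩ := he
  rw [hv]
  rcases Sym2.eq_iff.1 hi with ⟨-, rfl⟩ | ⟨-, rfl⟩ <;> exact ⟨_, rfl⟩

lemma IsNNTree.seeds_subset (h : IsNNTree x T) (r : ℝ) (m : ℕ) : seeds T r m ⊆ T.verts := by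
  rintro v (⟨-, hv⟩ | ⟨u, hu, -⟩)
  · exact hv
  · exact h.mem_verts_of_mem_edges hu

lemma IsNNTree.expand_subset (h : IsNNTree x T) (s : ℝ) {S : Set (Torus d)} (hS : S ⊆ T.verts) :
    expand T s S ⊆ T.verts := by
  rintro v (hv | ⟨u, -, hu, -⟩)
  · exact hS hv
  · exact h.mem_verts_of_mem_edges hu

lemma IsNNTree.iterate_expand_subset (h : IsNNTree x T) (s : ℝ) {S : Set (Torus d)}
    (hS : S ⊆ T.verts) (k : ℕ) : (expand T s)^[k] S ⊆ T.verts := by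
  induction k with
  | zero => exact hS
  | succ k ih =>
    rw [Function.iterate_succ_apply']
    exact h.expand_subset s ih

lemma IsNNTree.candidates_subset (h : IsNNTree x T) (s r : ℝ) (m : ℕ) :
    candidates T s r m ⊆ T.verts :=
  h.iterate_expand_subset s (h.seeds_subset r m) m

lemma IsNNTree.finite_verts (h : IsNNTree x T) : T.verts.Finite := by
  obtain ⟨p, -, hv, -⟩ := h
  rw [hv]
  exact Set.finite_range x

lemma IsNNTree.coe_candidateProcedure (h : IsNNTree x T) (s r : ℝ) (m : ℕ) :
    (candidateProcedure s r m T : Set (Torus d)) = candidates T s r m := by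
  have hf : (candidates T s r m).Finite := h.finite_verts.subset (h.candidates_subset s r m)
  simp [candidateProcedure, hf]

/-- An edge of length at least `r` has its later end at distance at least `r` from all earlier
vertices, so these later ends are `r`-separated in the whole torus, and cells of side `r / d` count
them. The factor 2 accounts for the parents, the summand `m` for the trees with at most `m`
vertices. -/
lemma IsNNTree.ncard_seeds_le (h : IsNNTree x T) (hd : 0 < d) {r : ℝ} (hr : 0 < r) (m M : ℕ)
    (hM : d ≤ M * r) : (seeds T r m).ncard ≤ m + 2 * (M + 1) ^ d := by
  classical
  have hfin := h.finite_verts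
  obtain ⟨p, hp, hv, hE⟩ := h
  have hd' : (0 : ℝ) < d := by exact_mod_cast hd
  set A : Finset (Fin n) :=
    Finset.univ.filter fun i => 0 < (i : ℕ) ∧ r ≤ torusDist (x i) (x (p i)) with hA
  have hAc : A.card ≤ (M + 1) ^ d := by
    apply card_le_of_separated hd (div_pos hr hd') x 0 M A
    · intro a _ i
      refine (coord_lt_one _).le.trans ?_
      rw [← mul_div_assoc, le_div_iff₀ hd']
      linarith
    · intro a _ b hb hab
      rw [mul_div_cancel₀ _ hd'.ne']
      simp only [hA, Finset.mem_filter, Finset.mem_univ, true_and] at hb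
      exact hb.2.trans ((hp b hb.1).2 a hab)
  have h1 : {v | T.verts.ncard ≤ m ∧ v ∈ T.verts}.ncard ≤ m := by
    by_cases hm : T.verts.ncard ≤ m
    · simp [hm]
    · simp [hm]
  have h2 : {v | ∃ u, s(u, v) ∈ T.edges ∧ r ≤ torusDist u v}.ncard ≤ 2 * (M + 1) ^ d := by
    have hsub : {v | ∃ u, s(u, v) ∈ T.edges ∧ r ≤ torusDist u v} ⊆
        ((A.image x ∪ A.image (x ∘ p) : Finset (Torus d)) : Set (Torus d)) := by
      rintro v ⟨u, hu, hr'⟩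
      rw [hE] at hu
      obtain ⟨i, hi, hi'⟩ := hu
      simp only [Finset.coe_union, Finset.coe_image, Set.mem_union, Set.mem_image,
        Finset.mem_coe, hA, Finset.mem_filter, Finset.mem_univ, true_and, Function.comp]
      rcases Sym2.eq_iff.1 hi' with ⟨rfl, rfl⟩ | ⟨rfl, rfl⟩
      · exact Or.inr ⟨i, ⟨hi, hr'⟩, rfl⟩
      · exact Or.inl ⟨i, ⟨hi, by rwa [torusDist_comm]⟩, rfl⟩
    refine (Set.ncard_le_ncard hsub (Finset.finite_toSet _)).trans ?_
    rw [Set.ncard_coe_finset]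
    have := Finset.card_union_le (A.image x) (A.image (x ∘ p))
    have := Finset.card_image_le (s := A) (f := x)
    have := Finset.card_image_le (s := A) (f := x ∘ p)
    omega
  exact (Set.ncard_union_le _ _).trans (add_le_add h1 h2)

/-- Children of `u` at distances in `[ρ, 2ρ)` chose `u` although their earlier siblings were
available, so they are `ρ`-separated inside a ball of radius `2ρ`. Since all distances are at most
`d < s * 2 ^ J`, there are `J` dyadic scales; the last summand is the parent of `u`. -/
lemma IsNNTree.ncard_neighbors_le (h : IsNNTree x T) (hx : Function.Injective x) (hd : 0 < d)
    {s : ℝ} (hs : 0 < s) (J : ℕ) (hJ : d < s * 2 ^ J) (u : Torus d) :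
    {v | s(u, v) ∈ T.edges ∧ s ≤ torusDist u v}.Finite ∧
    {v | s(u, v) ∈ T.edges ∧ s ≤ torusDist u v}.ncard ≤ J * (4 * d + 1) ^ d + 1 := by
  classical
  have hfin : {v | s(u, v) ∈ T.edges ∧ s ≤ torusDist u v}.Finite :=
    h.finite_verts.subset fun v hv => h.mem_verts_of_mem_edges hv.1
  refine ⟨hfin, ?_⟩
  obtain ⟨p, hp, hv, hE⟩ := h
  have hd' : (0 : ℝ) < d := by exact_mod_cast hd
  by_cases hu : u ∈ Set.range x
  swap
  · have : {v | s(u, v) ∈ T.edges ∧ s ≤ torusDist u v} = ∅ := by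
      apply Set.eq_empty_of_forall_notMem
      rintro v ⟨hv, -⟩
      rw [hE] at hv
      obtain ⟨i, -, hi⟩ := hv
      rcases Sym2.eq_iff.1 hi with ⟨rfl, -⟩ | ⟨rfl, -⟩ <;> exact hu ⟨_, rfl⟩
    simp [this]
  obtain ⟨k, rfl⟩ := hu
  set A : Finset (Fin n) := Finset.univ.filter fun i =>
    0 < (i : ℕ) ∧ p i = k ∧ s ≤ torusDist (x i) (x k) with hA
  set B : ℕ → Finset (Fin n) := fun a => A.filter fun i =>
    s * 2 ^ a ≤ torusDist (x i) (x k) ∧ torusDist (x i) (x k) < s * 2 ^ (a + 1) with hB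
  have hBc : ∀ a, (B a).card ≤ (4 * d + 1) ^ d := by
    intro a
    have hρ : 0 < s * 2 ^ a := by positivity
    set ρ := s * 2 ^ a with hρd
    -- The translation takes `x k` to the point with all coordinates `2ρ`, so the ball of radius
    -- `2ρ` has representatives in `[0, 4ρ]`, that is `4 * d` cell sides `ρ / d`. If `4ρ` exceeds 1,
    -- reduction modulo 1 only decreases coordinates.
    apply card_le_of_separated hd (div_pos hρ hd') x
      (fun i => -(x k i) + ((2 * ρ : ℝ) : UnitAddCircle)) (4 * d) (B a)
    · intro b hb i
      simp only [hB, Finset.mem_filter] at hb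
      obtain ⟨t, ht, ht'⟩ := exists_coe_eq_abs_eq_norm (x b i - x k i)
      have h1 : |t| ≤ 2 * ρ := by
        rw [ht']
        refine (norm_le_torusDist _ _ _).trans (hb.2.2.le.trans ?_)
        rw [hρd, pow_succ]; linarith
      have e : x b i + (-(x k i) + ((2 * ρ : ℝ) : UnitAddCircle)) =
          ((t + 2 * ρ : ℝ) : UnitAddCircle) := by
        rw [AddCircle.coe_add, ht]; abel
      rw [e]
      rw [abs_le] at h1
      refine (coord_coe_le (by linarith)).trans ?_
      have : ((4 * d : ℕ) : ℝ) * (ρ / d) = 4 * ρ := by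
        push_cast; field_simp
      rw [this]; linarith
    · intro b hb c hc hbc
      simp only [hB, hA, Finset.mem_filter, Finset.mem_univ, true_and] at hb hc
      rw [mul_div_cancel₀ _ hd'.ne']
      refine hc.2.1.trans ?_
      rw [← hc.1.2.1]
      exact (hp c hc.1.1).2 b hbc
  have hAc : A.card ≤ J * (4 * d + 1) ^ d := by
    have hsub : A ⊆ (Finset.range J).biUnion B := by
      intro i hi
      have hi' := hi
      simp only [hA, Finset.mem_filter, Finset.mem_univ, true_and] at hi'
      obtain ⟨a, ha, ha'⟩ := exists_nat_pow_near (x := torusDist (x i) (x k) / s)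
        ((one_le_div hs).2 hi'.2.2) (one_lt_two)
      rw [le_div_iff₀ hs] at ha
      rw [div_lt_iff₀ hs] at ha'
      simp only [Finset.mem_biUnion, Finset.mem_range, hB, Finset.mem_filter]
      refine ⟨a, ?_, hi, by linarith, by linarith⟩
      have h3 : (2 : ℝ) ^ a < 2 ^ J := by
        have := torusDist_le (x i) (x k)
        have h4 : (2 : ℝ) ^ a * s < 2 ^ J * s := by linarith
        exact lt_of_mul_lt_mul_right h4 hs.le
      exact (pow_lt_pow_iff_right₀ one_lt_two).1 h3
    refine (Finset.card_le_card hsub).trans ?_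
    refine (Finset.card_biUnion_le_card_mul _ _ _ fun a _ => hBc a).trans ?_
    simp
  have hsub : {v | s(x k, v) ∈ T.edges ∧ s ≤ torusDist (x k) v} ⊆
      ((A.image x ∪ {x (p k)} : Finset (Torus d)) : Set (Torus d)) := by
    rintro v ⟨hv, hsv⟩
    rw [hE] at hv
    obtain ⟨i, hi, hi'⟩ := hv
    simp only [Finset.coe_union, Finset.coe_image, Set.mem_union, Set.mem_image,
      Finset.mem_coe, hA, Finset.mem_filter, Finset.mem_univ, true_and, Finset.coe_singleton,
      Set.mem_singleton_iff]
    rcases Sym2.eq_iff.1 hi' with ⟨h1, rfl⟩ | ⟨h1, rfl⟩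
    · rw [hx h1]; exact Or.inr rfl
    · exact Or.inl ⟨i, ⟨hi, (hx h1).symm, by rwa [torusDist_comm]⟩, rfl⟩
  refine (Set.ncard_le_ncard hsub (Finset.finite_toSet _)).trans ?_
  rw [Set.ncard_coe_finset]
  have := Finset.card_union_le (A.image x) {x (p k)}
  have := Finset.card_image_le (s := A) (f := x)
  simp only [Finset.card_singleton] at *
  omega

lemma ncard_expand_le {s : ℝ} {D : ℕ} (hD : ∀ u,
      {v | s(u, v) ∈ T.edges ∧ s ≤ torusDist u v}.Finite ∧
      {v | s(u, v) ∈ T.edges ∧ s ≤ torusDist u v}.ncard ≤ D) {S : Set (Torus d)}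
    (hS : S.Finite) : (expand T s S).ncard ≤ S.ncard * (D + 1) := by
  classical
  have hsub : expand T s S ⊆ ((hS.toFinset.biUnion fun u => {u} ∪ (hD u).1.toFinset :
      Finset (Torus d)) : Set (Torus d)) := by
    rintro v (hv | ⟨u, hu, hv⟩)
    · simp only [Finset.coe_biUnion, Set.mem_iUnion]
      exact ⟨v, by simpa using hv, by simp⟩
    · simp only [Finset.coe_biUnion, Set.mem_iUnion]
      exact ⟨u, by simpa using hu, by simp [hv]⟩
  refine (Set.ncard_le_ncard hsub (Finset.finite_toSet _)).trans ?_
  rw [Set.ncard_coe_finset, Set.ncard_eq_toFinset_card S hS]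
  apply Finset.card_biUnion_le_card_mul
  intro u _
  refine (Finset.card_union_le _ _).trans ?_
  rw [← Set.ncard_eq_toFinset_card _ (hD u).1, Finset.card_singleton]
  have := (hD u).2
  omega

lemma IsNNTree.card_candidateProcedure_le (h : IsNNTree x T) (hx : Function.Injective x)
    (hd : 0 < d) {s r : ℝ} (hs : 0 < s) (hr : 0 < r) (m M J : ℕ) (hM : d ≤ M * r)
    (hJ : d < s * 2 ^ J) : (candidateProcedure s r m T).card ≤
      (m + 2 * (M + 1) ^ d) * (J * (4 * d + 1) ^ d + 2) ^ m := by
  have key : ∀ k, ((expand T s)^[k] (seeds T r m)).ncard ≤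
      (m + 2 * (M + 1) ^ d) * (J * (4 * d + 1) ^ d + 2) ^ k := by
    intro k
    induction k with
    | zero => simpa using h.ncard_seeds_le hd hr m M hM
    | succ k ih =>
      rw [Function.iterate_succ_apply', pow_succ, ← mul_assoc]
      refine (ncard_expand_le (h.ncard_neighbors_le hx hd hs J hJ)
        (h.finite_verts.subset (h.iterate_expand_subset s (h.seeds_subset r m) k))).trans ?_
      exact Nat.mul_le_mul_right _ ih
  rw [← Set.ncard_coe_finset, h.coe_candidateProcedure]
  exact key m

/-! ### Finding the root -/

/-- If the first `m` vertices are not within `s` of each other, and not all within `m * r` of the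
root in every coordinate, then the root is a candidate. -/
lemma IsNNTree.root_mem_candidates (h : IsNNTree x T) {s r : ℝ} {m : ℕ} (hn : 0 < n)
    (hsep : ∀ i k : Fin n, (i : ℕ) < m → (k : ℕ) < m → i ≠ k → s ≤ torusDist (x i) (x k))
    (hfar : m ≤ n → ∃ i : Fin n, (i : ℕ) < m ∧ ∃ c, (m : ℝ) * r < ‖x i c - x ⟨0, hn⟩ c‖)
    (hr : 0 ≤ r) : x ⟨0, hn⟩ ∈ candidates T s r m := by
  obtain ⟨p, hp, hv, hE⟩ := h
  by_cases hm : T.verts.ncard ≤ m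
  · exact subset_iterate_expand _ _ _ _ (Or.inl ⟨hm, hv ▸ ⟨_, rfl⟩⟩)
  have hmn : m ≤ n := by
    have : T.verts.ncard ≤ n := by
      rw [hv, ← Set.image_univ]
      refine (Set.ncard_image_le Set.finite_univ).trans ?_
      simp
    omega
  obtain ⟨i, him, hir⟩ : ∃ i : Fin n, (i : ℕ) < m ∧ 0 < (i : ℕ) ∧
      r ≤ torusDist (x i) (x (p i)) := by
    by_contra! hcon
    -- If all early edges are shorter than `r`, each step to the parent moves a coordinate by at
    -- most `r` and lowers the index, so the vertex `k` is within `k * r` of the root.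
    have hclose : ∀ k : ℕ, ∀ hk : k < n, k < m → ∀ c,
        ‖x ⟨k, hk⟩ c - x ⟨0, hn⟩ c‖ ≤ k * r := by
      intro k
      induction k using Nat.strong_induction_on with
      | _ k ih =>
        intro hk hkm c
        rcases Nat.eq_zero_or_pos k with rfl | hk0
        · simp
        · have h1 := hcon ⟨k, hk⟩ hkm hk0
          have h2 : p ⟨k, hk⟩ < ⟨k, hk⟩ := (hp ⟨k, hk⟩ hk0).1
          have h3 : ((p ⟨k, hk⟩ : Fin n) : ℕ) < k := h2
          have h4 := ih _ h3 (p ⟨k, hk⟩).2 (h3.trans hkm) c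
          have h5 := norm_le_torusDist (x ⟨k, hk⟩) (x (p ⟨k, hk⟩)) c
          have h6 := norm_sub_le_norm_sub_add_norm_sub (x ⟨k, hk⟩ c) (x (p ⟨k, hk⟩) c)
            (x ⟨0, hn⟩ c)
          have h7 : (((p ⟨k, hk⟩ : Fin n) : ℕ) : ℝ) + 1 ≤ k := by exact_mod_cast h3
          simp only [Fin.eta] at h4
          nlinarith
    obtain ⟨i, him, c, hc⟩ := hfar hmn
    have := hclose i i.2 him c
    have : (i : ℝ) * r ≤ m * r := by gcongr
    simp only [Fin.eta] at *
    linarith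
  -- Ancestors have smaller indices, so the path from the vertex `k` to the root has at most `k`
  -- edges, and separation makes each of them usable for `expand`.
  have hpath : ∀ k : ℕ, ∀ hk : k < n, k < m → ∀ S : Set (Torus d), x ⟨k, hk⟩ ∈ S →
      x ⟨0, hn⟩ ∈ (expand T s)^[k] S := by
    intro k
    induction k using Nat.strong_induction_on with
    | _ k ih =>
      intro hk hkm S hS
      rcases Nat.eq_zero_or_pos k with rfl | hk0
      · exact hS
      · have h2 : p ⟨k, hk⟩ < ⟨k, hk⟩ := (hp ⟨k, hk⟩ hk0).1
        have h3 : ((p ⟨k, hk⟩ : Fin n) : ℕ) < k := h2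
        have h4 : x (p ⟨k, hk⟩) ∈ expand T s S := by
          refine Or.inr ⟨_, hS, ?_, hsep _ _ hkm (h3.trans hkm) h2.ne'⟩
          rw [hE]
          exact ⟨⟨k, hk⟩, hk0, rfl⟩
        have h5 := ih _ h3 (p ⟨k, hk⟩).2 (h3.trans hkm) _ h4
        rw [← Function.iterate_succ_apply] at h5
        exact iterate_expand_mono _ _ _ h3 h5
  have h1 : x i ∈ seeds T r m := by
    refine Or.inr ⟨x (p i), ?_, by rw [torusDist_comm]; exact hir.2⟩
    rw [hE]
    exact ⟨i, hir.1, Sym2.eq_swap⟩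
  have h2 := hpath i i.2 him _ h1
  unfold candidates
  exact iterate_expand_mono _ _ _ him.le h2

end Candidates

/-! ### Probabilities of boxes -/

section Boxes

variable {d : ℕ}

instance : IsProbabilityMeasure (volume : Measure UnitAddCircle) :=
  ⟨by simp [AddCircle.measure_univ]⟩

/-- The minimum with 1 is there because a ball of radius at least `1/2` is the whole circle. -/
lemma volume_box {ι : Type*} [Fintype ι] (a : ι → Torus d) (I : Finset ι) (ρ : ℝ) :
    volume {y : ι → Torus d | ∀ j ∈ I, ∀ c, ‖y j c - a j c‖ ≤ ρ} =
      ENNReal.ofReal (min 1 (2 * ρ)) ^ (d * I.card) := by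
  classical
  have e : {y : ι → Torus d | ∀ j ∈ I, ∀ c, ‖y j c - a j c‖ ≤ ρ} =
      Set.pi Set.univ fun j => if j ∈ I then
        (Set.pi Set.univ fun c => Metric.closedBall (a j c) ρ : Set (Torus d)) else Set.univ := by
    ext y
    simp only [Set.mem_ofPred_eq, Set.mem_pi, Set.mem_univ, true_imp_iff]
    refine forall_congr' fun j => ?_
    by_cases hj : j ∈ I
    · simp [hj, dist_eq_norm]
    · simp [hj]
  rw [e, volume_pi_pi]
  have h1 : ∀ j, volume (if j ∈ I then
        (Set.pi Set.univ fun c => Metric.closedBall (a j c) ρ : Set (Torus d)) else Set.univ) =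
      if j ∈ I then ENNReal.ofReal (min 1 (2 * ρ)) ^ d else 1 := by
    intro j
    split_ifs
    · rw [volume_pi_pi]
      simp [AddCircle.volume_closedBall]
    · exact measure_univ
  simp_rw [h1]
  rw [Finset.prod_ite]
  simp [pow_mul]

/-- The centre is itself random: splitting off the coordinate `z` and conditioning on it (Fubini)
leaves a box with a fixed centre. -/
lemma volume_cluster_le {n : ℕ} (z : Fin n) (I : Finset (Fin n)) (hz : z ∉ I) (ρ : ℝ) :
    volume {y : Fin n → Torus d | ∀ j ∈ I, ∀ c, ‖y j c - y z c‖ ≤ ρ} ≤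
      ENNReal.ofReal (2 * ρ) ^ (d * I.card) := by
  classical
  obtain _ | n := n
  · exact z.elim0
  set J : Finset (Fin n) := Finset.univ.filter fun j => z.succAbove j ∈ I with hJ
  have hcard : J.card = I.card := by
    have : I = J.map (Fin.succAboveEmb z) := by
      ext i
      simp only [hJ, Finset.mem_map, Finset.mem_filter, Finset.mem_univ, true_and]
      constructor
      · intro hi
        obtain ⟨j, rfl⟩ := Fin.exists_succAbove_eq (x := i) (y := z) (fun h => hz (h ▸ hi))
        exact ⟨j, hi, rfl⟩
      · rintro ⟨j, hj, rfl⟩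
        exact hj
    rw [this, Finset.card_map]
  set S : Set (Torus d × (Fin n → Torus d)) :=
    {q | ∀ j ∈ J, ∀ c, ‖q.2 j c - q.1 c‖ ≤ ρ} with hS
  have hSm : MeasurableSet S := by
    apply IsClosed.measurableSet
    simp only [hS, Set.ofPred_forall]
    refine isClosed_iInter fun j => isClosed_iInter fun _ => isClosed_iInter fun c => ?_
    exact isClosed_le (by fun_prop) continuous_const
  have hpre : {y : Fin (n + 1) → Torus d | ∀ j ∈ I, ∀ c, ‖y j c - y z c‖ ≤ ρ} =
      MeasurableEquiv.piFinSuccAbove (fun _ => Torus d) z ⁻¹' S := by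
    ext y
    simp only [Set.mem_ofPred_eq, Set.mem_preimage, hS, hJ, Finset.mem_filter, Finset.mem_univ,
      true_and, MeasurableEquiv.piFinSuccAbove_apply, Fin.insertNthEquiv_symm_apply,
      Fin.removeNth]
    constructor
    · intro h j hj c
      exact h _ hj c
    · intro h i hi c
      obtain ⟨j, rfl⟩ := Fin.exists_succAbove_eq (x := i) (y := z) (fun h => hz (h ▸ hi))
      exact h j hi c
  rw [hpre, (volume_preserving_piFinSuccAbove (fun _ => Torus d) z).measure_preimage
    hSm.nullMeasurableSet]
  change (volume.prod volume) S ≤ _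
  rw [Measure.prod_apply hSm]
  calc ∫⁻ a, volume (Prod.mk a ⁻¹' S) ≤ ∫⁻ _a : Torus d, ENNReal.ofReal (2 * ρ) ^ (d * I.card) := by
        gcongr with a
        have := volume_box (fun _ => a) J ρ
        rw [hcard] at this
        refine le_trans (le_of_eq this) ?_
        gcongr
        exact min_le_right _ _
    _ = _ := by rw [lintegral_const, measure_univ, mul_one]

lemma volume_near_le {n : ℕ} {i k : Fin n} (hik : i ≠ k) (s : ℝ) :
    volume {y : Fin n → Torus d | torusDist (y i) (y k) < s} ≤ ENNReal.ofReal (2 * s) ^ d := by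
  have h := volume_cluster_le (d := d) k {i} (by simpa using hik.symm) s
  rw [Finset.card_singleton, mul_one] at h
  refine (measure_mono ?_).trans h
  intro y hy j hj c
  rw [Finset.mem_singleton.1 hj]
  exact (norm_le_torusDist _ _ _).trans (le_of_lt hy)

end Boxes

/-! ### The success probability of the procedure -/

lemma missEvent_candidateProcedure_subset {d n : ℕ} (hn : 0 < n) {s r : ℝ} (hr : 0 ≤ r) (m : ℕ) :
    missEvent (d := d) (candidateProcedure s r m) n ⊆
      (⋃ i : Fin n, ⋃ k : Fin n, {x | ((i : ℕ) < m ∧ (k : ℕ) < m ∧ i ≠ k) ∧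
        torusDist (x i) (x k) < s}) ∪
      {x | m ≤ n ∧ ∀ i : Fin n, (i : ℕ) < m → ∀ c, ‖x i c - x ⟨0, hn⟩ c‖ ≤ m * r} := by
  rintro x ⟨T, hT, hx⟩
  by_contra hcon
  simp only [Set.mem_union, Set.mem_iUnion, Set.mem_ofPred_eq, not_or, not_exists, not_and,
    not_forall, not_lt, not_le] at hcon
  apply hx
  refine ⟨⟨0, hn⟩, rfl, ?_⟩
  rw [← Finset.mem_coe, hT.coe_candidateProcedure]
  apply hT.root_mem_candidates hn _ _ hr
  · intro i k hi hk hik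
    exact hcon.1 i k ⟨hi, hk, hik⟩
  · intro hmn
    obtain ⟨i, hi, c, hc⟩ := hcon.2 hmn
    exact ⟨i, hi, c, hc⟩

/-- A union bound: at most `m ^ 2` ordered pairs can be too close, and the clustering event
constrains the `m - 1` early vertices other than the root. -/
lemma volume_missEvent_candidateProcedure_le {d n : ℕ} (hn : 0 < n) {s r : ℝ} (hr : 0 ≤ r)
    (m : ℕ) :
    volume (missEvent (d := d) (candidateProcedure s r m) n) ≤
      m ^ 2 * ENNReal.ofReal (2 * s) ^ d + ENNReal.ofReal (2 * (m * r)) ^ (d * (m - 1)) := by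
  classical
  refine (measure_mono (missEvent_candidateProcedure_subset hn hr m)).trans ?_
  refine (measure_union_le _ _).trans (add_le_add ?_ ?_)
  · set F : Finset (Fin n) := Finset.univ.filter fun i => (i : ℕ) < m with hF
    have hFc : F.card ≤ m := by
      have : F.card ≤ (Finset.range m).card :=
        Finset.card_le_card_of_injOn (fun i => (i : ℕ)) (fun i hi => by simpa [hF] using hi)
          (fun i _ j _ h => Fin.ext h)
      simpa using this
    have hsub : (⋃ i : Fin n, ⋃ k : Fin n, {x : Fin n → Torus d |
        ((i : ℕ) < m ∧ (k : ℕ) < m ∧ i ≠ k) ∧ torusDist (x i) (x k) < s}) ⊆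
        ⋃ q ∈ F ×ˢ F, {x : Fin n → Torus d | q.1 ≠ q.2 ∧ torusDist (x q.1) (x q.2) < s} := by
      intro x hx
      simp only [Set.mem_iUnion, Set.mem_ofPred_eq] at hx ⊢
      obtain ⟨i, k, ⟨hi, hk, hik⟩, h⟩ := hx
      exact ⟨(i, k), by simp [hF, hi, hk], hik, h⟩
    refine (measure_mono hsub).trans ((measure_biUnion_finset_le _ _).trans ?_)
    calc ∑ q ∈ F ×ˢ F, volume {x : Fin n → Torus d | q.1 ≠ q.2 ∧ torusDist (x q.1) (x q.2) < s}
        ≤ ∑ _q ∈ F ×ˢ F, ENNReal.ofReal (2 * s) ^ d := by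
          gcongr with q
          by_cases hq : q.1 = q.2
          · simp [hq]
          · simpa [hq] using volume_near_le (d := d) hq s
      _ = ((F.card * F.card : ℕ) : ENNReal) * ENNReal.ofReal (2 * s) ^ d := by
          simp
      _ ≤ _ := by
          gcongr
          rw [sq]
          exact_mod_cast Nat.mul_le_mul hFc hFc
  · by_cases hmn : m ≤ n
    · set I : Finset (Fin n) := Finset.univ.filter fun i => 0 < (i : ℕ) ∧ (i : ℕ) < m with hI
      have hIc : I.card = m - 1 := by
        have : I.map Fin.valEmbedding = Finset.Ico 1 m := by
          ext a
          simp only [hI, Finset.mem_map, Finset.mem_filter, Finset.mem_univ, true_and,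
            Fin.valEmbedding_apply, Finset.mem_Ico]
          constructor
          · rintro ⟨i, hi, rfl⟩
            exact hi
          · intro ha
            exact ⟨⟨a, by omega⟩, ha, rfl⟩
        rw [← Finset.card_map Fin.valEmbedding, this, Nat.card_Ico]
      have h := volume_cluster_le (d := d) (⟨0, hn⟩ : Fin n) I (by simp [hI]) (m * r)
      rw [hIc] at h
      refine (measure_mono ?_).trans h
      rintro y ⟨-, hy⟩ j hj c
      simp only [hI, Finset.mem_filter, Finset.mem_univ, true_and] at hj
      exact hy j hj.2 c
    -- With fewer than `m` vertices all of them are seeds, and the clustering event is empty.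
    · simp [hmn]

lemma le_successProb_candidateProcedure {d n : ℕ} (hn : 0 < n) {s r : ℝ} (hs : 0 ≤ s) (hr : 0 ≤ r)
    (m : ℕ) :
    1 - (m ^ 2 * (2 * s) ^ d + (2 * (m * r)) ^ (d * (m - 1))) ≤
      successProb (d := d) (candidateProcedure s r m) n := by
  have h := volume_missEvent_candidateProcedure_le (d := d) hn (s := s) hr m
  unfold successProb
  apply sub_le_sub_left
  rw [Measure.real]
  apply ENNReal.toReal_le_of_le_ofReal (by positivity)
  rw [ENNReal.ofReal_add (by positivity) (by positivity), ENNReal.ofReal_mul (by positivity),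
    ENNReal.ofReal_pow (by positivity), ENNReal.ofReal_pow (by positivity),
    ENNReal.ofReal_pow (by positivity), ENNReal.ofReal_natCast]
  exact h

/-! ### The parameters of the procedure -/

/-- `k` is the least exponent with `1 / ε ≤ 2 ^ k`. -/
def IsScale (ε : ℝ) (k : ℕ) : Prop := 1 ≤ 2 ^ k * ε ∧ ∀ i < k, 2 ^ i * ε < 1

/-- `q` is the least number whose square is at least `k`. -/
def IsCeilSqrt (k q : ℕ) : Prop := k ≤ q ^ 2 ∧ ∀ i < q, i ^ 2 < k

lemma exists_isScale {ε : ℝ} (hε : 0 < ε) : ∃ k, IsScale ε k := by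
  classical
  have h : ∃ k : ℕ, 1 ≤ 2 ^ k * ε := by
    obtain ⟨k, hk⟩ := pow_unbounded_of_one_lt (1 / ε) (one_lt_two (α := ℝ))
    exact ⟨k, by rw [div_lt_iff₀ hε] at hk; exact hk.le⟩
  exact ⟨Nat.find h, Nat.find_spec h, fun i hi => not_le.1 (Nat.find_min h hi)⟩

lemma exists_isCeilSqrt (k : ℕ) : ∃ q, IsCeilSqrt k q := by
  classical
  have h : ∃ q : ℕ, k ≤ q ^ 2 := ⟨k, Nat.le_self_pow two_ne_zero k⟩
  exact ⟨Nat.find h, Nat.find_spec h, fun i hi => not_le.1 (Nat.find_min h hi)⟩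

lemma four_mul_sq_le_two_pow {q : ℕ} (hq : 10 ≤ q) : 4 * (q + 2) ^ 2 ≤ 2 ^ q := by
  induction q, hq using Nat.le_induction with
  | base => norm_num
  | succ q hq ih => rw [pow_succ 2 q]; nlinarith

/-- The condition `10 ≤ q` gives `4 (q + 2)² ≤ 2 ^ q`. The first term is then at most `2 ^ q * ε *
ε`, where `2 ^ q * ε < 1/2`. In the second, the base `b` satisfies `b ^ 2 ≤ 2 ^ (-q)`, and `q ^ 2 ≥
k` makes its power at most `2 ^ (-(k + 1))`. -/
lemma failure_le {d q k : ℕ} {ε : ℝ} (hd : 2 ≤ d) (hε : 0 < ε) (hk : IsScale ε k)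
    (hq : IsCeilSqrt k q) (h10 : 10 ≤ q) :
    ((q + 2 : ℕ) : ℝ) ^ 2 * (2 * ε) ^ d +
      (2 * (((q + 2 : ℕ) : ℝ) * (1 / 2) ^ q)) ^ (d * (q + 2 - 1)) ≤ ε := by
  have h4 : 4 * ((q : ℝ) + 2) ^ 2 ≤ 2 ^ q := by exact_mod_cast four_mul_sq_le_two_pow h10
  have hqk := hq.2 (q - 1) (by omega)
  -- For `q ≥ 10` one has `q + 1 < (q - 1) ^ 2 < k`.
  have hqk' : q + 1 < k := by
    obtain ⟨a, rfl⟩ := Nat.exists_eq_add_of_le' (show 1 ≤ q by omega)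
    simp only [Nat.add_sub_cancel] at hqk
    nlinarith
  have hε2 : 2 ^ (q + 1) * ε < 1 := hk.2 _ hqk'
  have hpow : (0 : ℝ) < 2 ^ q := by positivity
  have hbig : (1 : ℝ) ≤ 2 ^ q := one_le_pow₀ one_le_two
  have h1 : ((q + 2 : ℕ) : ℝ) ^ 2 * (2 * ε) ^ d ≤ ε / 2 := by
    have hle : 2 * ε ≤ 1 := by
      rw [pow_succ] at hε2
      nlinarith
    calc ((q + 2 : ℕ) : ℝ) ^ 2 * (2 * ε) ^ d ≤ ((q + 2 : ℕ) : ℝ) ^ 2 * (2 * ε) ^ 2 := by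
          gcongr ?_ * ?_
          exact pow_le_pow_of_le_one (by positivity) hle hd
      _ = (4 * ((q : ℝ) + 2) ^ 2) * ε * ε := by push_cast; ring
      _ ≤ 2 ^ q * ε * ε := by gcongr
      _ ≤ 1 / 2 * ε := by
          gcongr
          rw [pow_succ] at hε2
          linarith
      _ = ε / 2 := by ring
  have h2 : (2 * (((q + 2 : ℕ) : ℝ) * (1 / 2) ^ q)) ^ (d * (q + 2 - 1)) ≤ ε / 2 := by
    set b := 2 * (((q + 2 : ℕ) : ℝ) * (1 / 2) ^ q) with hb
    have hb0 : 0 ≤ b := by positivity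
    have hb2 : b ^ 2 ≤ (1 / 2) ^ q := by
      have e : b ^ 2 = (4 * ((q : ℝ) + 2) ^ 2) * ((1 / 2) ^ q) ^ 2 := by
        rw [hb]; push_cast; ring
      rw [e]
      calc _ ≤ (2 : ℝ) ^ q * ((1 / 2) ^ q) ^ 2 := by gcongr
        _ = (2 * (1 / 2)) ^ q * (1 / 2 : ℝ) ^ q := by rw [mul_pow]; ring
        _ = _ := by norm_num
    have hb1 : b ≤ 1 := by
      have : b ^ 2 ≤ 1 := hb2.trans (pow_le_one₀ (by norm_num) (by norm_num))
      nlinarith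
    calc b ^ (d * (q + 2 - 1)) ≤ b ^ (2 * (q + 1)) :=
          pow_le_pow_of_le_one hb0 hb1 (Nat.mul_le_mul hd (by omega))
      _ = (b ^ 2) ^ (q + 1) := by rw [pow_mul]
      _ ≤ ((1 / 2) ^ q) ^ (q + 1) := by gcongr
      _ = (1 / 2) ^ (q * (q + 1)) := by rw [pow_mul]
      _ ≤ (1 / 2) ^ (k + 1) := by
          apply pow_le_pow_of_le_one (by norm_num) (by norm_num)
          have := hq.1
          nlinarith
      _ ≤ ε / 2 := by
          rw [one_div, inv_pow, inv_le_iff_one_le_mul₀ (by positivity), pow_succ]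
          have := hk.1
          linarith
  linarith

lemma le_successProb {d n q k : ℕ} {ε : ℝ} (hn : 0 < n) (hd : 2 ≤ d) (hε : 0 < ε)
    (hk : IsScale ε k) (hq : IsCeilSqrt k q) (h10 : 10 ≤ q) :
    1 - ε ≤ successProb (d := d) (candidateProcedure ε ((1 / 2) ^ q) (q + 2)) n := by
  refine le_trans ?_ (le_successProb_candidateProcedure hn hε.le (by positivity) _)
  have := failure_le hd hε hk hq h10
  linarith

/-! ### Asymptotics -/

/-- The logarithm is `o(L^(1/4))`; squaring gives `o(√L)`. This is what turns `√L * log L` into `L /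
log L`. -/
lemma eventually_mul_log_sq_le (G : ℝ) : ∀ᶠ L : ℝ in atTop, G * Real.log L ^ 2 ≤ √L := by
  have hG : 0 < |G| + 1 := by positivity
  have h := (isLittleO_log_rpow_atTop (show (0 : ℝ) < 1 / 4 by norm_num)).def
    (show (0 : ℝ) < 1 / (|G| + 1) by positivity)
  filter_upwards [h, eventually_ge_atTop 1] with L hL h1
  rw [Real.norm_of_nonneg (Real.log_nonneg h1),
    Real.norm_of_nonneg (Real.rpow_nonneg (by linarith) _)] at hL
  have hs : (L ^ (1 / 4 : ℝ)) ^ 2 = √L := by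
    rw [← Real.rpow_natCast, ← Real.rpow_mul (by linarith), Real.sqrt_eq_rpow]
    norm_num
  have h0 := Real.log_nonneg h1
  calc G * Real.log L ^ 2 ≤ (|G| + 1) * Real.log L ^ 2 := by
        gcongr; linarith [le_abs_self G]
    _ ≤ (|G| + 1) * (1 / (|G| + 1) * L ^ (1 / 4 : ℝ)) ^ 2 := by gcongr
    _ = 1 / (|G| + 1) * √L := by rw [mul_pow, hs]; field_simp
    _ ≤ 1 * √L := by
        gcongr
        rw [div_le_one hG]; linarith [abs_nonneg G]
    _ = _ := one_mul _

/-- Needed for the running time: the left side bounds `d + k + q + 2` when `a = d + 2`, and with `w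
= √L` it is a quadratic polynomial in `w`, eventually below `w ^ 3`. -/
lemma eventually_le_exp_sqrt (a : ℝ) : ∀ᶠ L : ℝ in atTop, a + 2 * L + 3 * √L ≤ Real.exp √L := by
  have h1 : ∀ᶠ w : ℝ in atTop, a + 2 * w ^ 2 + 3 * w ≤ Real.exp w := by
    have h := (Real.isLittleO_pow_exp_atTop (n := 3)).def one_pos
    filter_upwards [h, eventually_ge_atTop (|a| + 10)] with w hw hwa
    have h0 : 0 ≤ w := by linarith [abs_nonneg a]
    rw [one_mul, Real.norm_of_nonneg (by positivity), Real.norm_of_nonneg (Real.exp_pos _).le] at hw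
    refine le_trans ?_ hw
    have := le_abs_self a
    have := abs_nonneg a
    nlinarith [mul_nonneg h0 h0, mul_nonneg (mul_nonneg h0 h0) (by linarith : 0 ≤ w - 10)]
  filter_upwards [Real.tendsto_sqrt_atTop.eventually h1, eventually_ge_atTop 0] with L hL h0
  rwa [Real.sq_sqrt h0] at hL

lemma IsScale.le_two_mul {ε : ℝ} {k : ℕ} (hk : IsScale ε k) (hε : 0 < ε)
    (hL : 2 ≤ Real.log (1 / ε)) : (k : ℝ) ≤ 2 * Real.log (1 / ε) := by
  rcases Nat.eq_zero_or_pos k with rfl | h0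
  · simp only [Nat.cast_zero]; linarith
  have h := hk.2 (k - 1) (by omega)
  rw [← lt_div_iff₀ hε] at h
  have h' := Real.log_lt_log (by positivity) h
  rw [Real.log_pow, Nat.cast_sub h0, Nat.cast_one] at h'
  have := Real.log_two_gt_d9
  have hk1 : (1 : ℝ) ≤ k := by exact_mod_cast h0
  nlinarith

lemma IsScale.log_le {ε : ℝ} {k : ℕ} (hk : IsScale ε k) (hε : 0 < ε) :
    Real.log (1 / ε) ≤ k := by
  have h := hk.1
  rw [← div_le_iff₀ hε] at h
  have h' := Real.log_le_log (by positivity) h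
  rw [Real.log_pow] at h'
  have := Real.log_two_lt_d9
  nlinarith [(Nat.cast_nonneg k : (0 : ℝ) ≤ k)]

lemma IsCeilSqrt.le_three_mul_sqrt {k q : ℕ} {L : ℝ} (hq : IsCeilSqrt k q) (hL : 1 ≤ L)
    (hk : (k : ℝ) ≤ 2 * L) : (q : ℝ) ≤ 3 * √L := by
  have hw : 1 ≤ √L := Real.one_le_sqrt.2 hL
  rcases Nat.eq_zero_or_pos q with rfl | h0
  · simp only [Nat.cast_zero]; linarith
  have h : ((q - 1 : ℕ) : ℝ) ^ 2 < k := by exact_mod_cast hq.2 (q - 1) (by omega)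
  rw [Nat.cast_sub h0, Nat.cast_one] at h
  have hs : √L ^ 2 = L := Real.sq_sqrt (by linarith)
  nlinarith

/-- For fixed `d` the dominant term of the exponent is `(q + 2) * log k`, of order `√L * log L`; the
number of seeds contributes only order `q`. -/
lemma size_le_exp {d q k : ℕ} (hd : 2 ≤ d) (hk : 1 ≤ k) (hq : 1 ≤ q) :
    (((q + 2 + 2 * (d * 2 ^ q + 1) ^ d) *
      ((d + k + 1) * (4 * d + 1) ^ d + 2) ^ (q + 2) : ℕ) : ℝ) ≤
    Real.exp ((q + 3) + 2 * d ^ 2 + q * d +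
      (q + 2) * (Real.log k + Real.log ((d + 2) * (4 * d + 1) ^ d + 2))) := by
  have hdR : (2 : ℝ) ≤ d := by exact_mod_cast hd
  have hkR : (1 : ℝ) ≤ k := by exact_mod_cast hk
  set B : ℝ := (d + 2) * (4 * d + 1) ^ d + 2 with hB
  have hBpos : 0 < B := by positivity
  rw [Real.exp_add]
  push_cast
  have two_pow_le : ∀ a : ℕ, (2 : ℝ) ^ a ≤ Real.exp a := fun a => by
    rw [← Real.exp_one_pow]
    gcongr
    linarith [Real.exp_one_gt_d9]
  have h1 : (q : ℝ) + 2 + 2 * (d * 2 ^ q + 1) ^ d ≤ Real.exp ((q + 3) + 2 * d ^ 2 + q * d) := by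
    have ha : (q : ℝ) + 2 ≤ 2 ^ (q + 2) := by
      exact_mod_cast (Nat.lt_two_pow_self (n := q + 2)).le
    have hb : ((d : ℝ) * 2 ^ q + 1) ^ d ≤ 2 ^ ((d + q + 1) * d) := by
      rw [pow_mul]
      gcongr
      have : (d : ℝ) ≤ 2 ^ d := by exact_mod_cast (Nat.lt_two_pow_self (n := d)).le
      have h2 : (1 : ℝ) ≤ 2 ^ q := one_le_pow₀ one_le_two
      have h3 : (1 : ℝ) ≤ 2 ^ d := one_le_pow₀ one_le_two
      rw [pow_succ, pow_add]
      nlinarith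
    set X : ℝ := 2 ^ (q + 2) with hX
    set Y : ℝ := 2 ^ ((d + q + 1) * d) with hY
    have hX2 : 2 ≤ X := by
      rw [hX, pow_add]
      have h2 : (1 : ℝ) ≤ 2 ^ q := one_le_pow₀ one_le_two
      linarith
    have hY1 : 2 ≤ Y := by
      rw [hY]
      exact le_self_pow₀ one_le_two (by positivity)
    calc (q : ℝ) + 2 + 2 * (d * 2 ^ q + 1) ^ d ≤ X + 2 * Y := by linarith
      _ ≤ 2 * X * Y := by nlinarith
      _ = 2 ^ (q + 3 + (d + q + 1) * d) := by rw [hX, hY]; ring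
      _ ≤ Real.exp ((q + 3 + (d + q + 1) * d : ℕ) : ℝ) := two_pow_le _
      _ ≤ _ := by
        apply Real.exp_le_exp.2
        push_cast
        nlinarith
  have h2 : (((d : ℝ) + k + 1) * (4 * d + 1) ^ d + 2) ^ (q + 2) ≤
      Real.exp ((q + 2) * (Real.log k + Real.log B)) := by
    rw [← Real.log_mul (by positivity) hBpos.ne', show ((q : ℝ) + 2) = ((q + 2 : ℕ) : ℝ) by
      push_cast; ring, ← Real.log_pow, Real.exp_log (by positivity)]
    gcongr
    rw [hB]
    have : (0 : ℝ) < (4 * d + 1) ^ d := by positivity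
    have h3 : (d : ℝ) + k + 1 ≤ k * (d + 2) := by nlinarith
    nlinarith
  gcongr

/-- All that is needed about the parameters, for small `ε`. -/
lemma exists_threshold (d : ℕ) (hd : 2 ≤ d) : ∃ ε₀ : ℝ, 0 < ε₀ ∧ ∀ ε : ℝ, 0 < ε → ε < ε₀ →
    ∀ k q : ℕ, IsScale ε k → IsCeilSqrt k q → 10 ≤ q ∧
      (((q + 2 + 2 * (d * 2 ^ q + 1) ^ d) *
        ((d + k + 1) * (4 * d + 1) ^ d + 2) ^ (q + 2) : ℕ) : ℝ) ≤
        Real.exp (Real.log (1 / ε) / Real.log (Real.log (1 / ε))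
                  + d * Real.log (Real.log (1 / ε))) ∧
      (d + k + q + 2 : ℝ) ≤ (1 / ε) ^ (1 / Real.log (Real.log (1 / ε)) : ℝ) := by
  have hdR : (2 : ℝ) ≤ d := by exact_mod_cast hd
  set B : ℝ := (d + 2) * (4 * d + 1) ^ d + 2 with hB
  have hB1 : 1 ≤ B := by rw [hB]; have : (0 : ℝ) < (4 * d + 1) ^ d := by positivity
                         nlinarith
  have hlB := Real.log_nonneg hB1
  -- The summands of `G` dominate, one by one, the terms of the exponent in `size_le_exp` after
  -- division by `√L * log L`, using `q ≤ 3 √L`, `log k ≤ log L + 1` and `1 ≤ log L`.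
  set G : ℝ := 6 + 2 * d ^ 2 + 3 * d + 5 * (2 + Real.log B) with hG
  have hG1 : 1 ≤ G := by rw [hG]; nlinarith
  obtain ⟨L₀, hL₀⟩ := eventually_atTop.1 ((eventually_mul_log_sq_le G).and
    ((eventually_le_exp_sqrt (d + 2)).and
      ((eventually_ge_atTop 100).and (Real.tendsto_log_atTop.eventually_ge_atTop 1))))
  refine ⟨Real.exp (-L₀), Real.exp_pos _, fun ε hε hlt k q hk hq => ?_⟩
  set L := Real.log (1 / ε) with hL
  have hLL : L₀ ≤ L := by
    rw [hL, one_div, Real.log_inv]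
    have := Real.log_lt_log hε hlt
    rw [Real.log_exp] at this
    linarith
  obtain ⟨h1, h2, h100, hy⟩ := hL₀ L hLL
  set y := Real.log L with hyd
  have hw : 1 ≤ √L := Real.one_le_sqrt.2 (by linarith)
  have hw2 : √L ^ 2 = L := Real.sq_sqrt (by linarith)
  have hk2 : (k : ℝ) ≤ 2 * L := hk.le_two_mul hε (by linarith)
  have hkL : L ≤ k := hk.log_le hε
  have hq3 : (q : ℝ) ≤ 3 * √L := hq.le_three_mul_sqrt (by linarith) hk2
  have hq10 : 10 ≤ q := by
    have : (k : ℝ) ≤ q ^ 2 := by exact_mod_cast hq.1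
    have : (10 : ℝ) ≤ q := by nlinarith [(Nat.cast_nonneg q : (0 : ℝ) ≤ q)]
    exact_mod_cast this
  have hk1 : 1 ≤ k := by
    have : (1 : ℝ) ≤ k := by linarith
    exact_mod_cast this
  have hq0 : (0 : ℝ) ≤ q := Nat.cast_nonneg q
  have hGw : G * √L * y ≤ L / y := by
    rw [le_div_iff₀ (by linarith)]
    nlinarith
  refine ⟨hq10, ?_, ?_⟩
  · refine (size_le_exp hd hk1 (by omega)).trans (Real.exp_le_exp.2 ?_)
    have hlogk : Real.log k ≤ y + 1 := by
      have h := Real.log_le_log (by linarith) hk2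
      rw [Real.log_mul (by norm_num) (by linarith)] at h
      linarith [Real.log_two_lt_d9]
    have hwy : 1 ≤ √L * y := by nlinarith
    have e1 : (q : ℝ) ≤ 3 * (√L * y) := by nlinarith
    have e2 : ((q : ℝ) + 2) * (Real.log k + Real.log B) ≤
        (5 * √L) * ((2 + Real.log B) * y) := by
      gcongr
      · linarith
      · nlinarith
    have e3 : (q : ℝ) * d ≤ 3 * (√L * y) * d := by gcongr
    have e4 : (2 : ℝ) * d ^ 2 ≤ 2 * d ^ 2 * (√L * y) := by
      have : (0 : ℝ) ≤ 2 * d ^ 2 := by positivity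
      nlinarith
    have e5 : ((q : ℝ) + 3) + 2 * d ^ 2 + q * d + (q + 2) * (Real.log k + Real.log B) ≤
        G * √L * y := by
      rw [hG]
      linarith
    -- The term `d * log L` of the stated bound is not needed, only its sign.
    have : 0 ≤ (d : ℝ) * y := by positivity
    linarith
  · rw [Real.rpow_def_of_pos (by positivity), ← hL, mul_one_div]
    calc (d + k + q + 2 : ℝ) ≤ d + 2 + 2 * L + 3 * √L := by linarith
      _ ≤ Real.exp √L := h2
      _ ≤ Real.exp (L / y) := by
        apply Real.exp_le_exp.2
        refine le_trans ?_ hGw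
        have : √L ≤ √L * y := by nlinarith
        nlinarith

/-! ### Lower bound on the failure probability by exchangeability -/

section Exchange

variable {d n : ℕ}

lemma exists_isNNTree (y : Fin n → Torus d) : ∃ T, IsNNTree y T := by
  have h : ∀ i : Fin n, ∃ k : Fin n, 0 < (i : ℕ) →
      k < i ∧ ∀ j : Fin n, j < i → torusDist (y i) (y k) ≤ torusDist (y i) (y j) := by
    intro i
    by_cases hi : 0 < (i : ℕ)
    · obtain ⟨k, hk, hmin⟩ := (Finset.Iio i).exists_min_image (fun j => torusDist (y i) (y j))
        ⟨⟨0, by omega⟩, by simpa [Fin.lt_def] using hi⟩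
      exact ⟨k, fun _ => ⟨by simpa using hk, fun j hj => hmin j (by simpa using hj)⟩⟩
    · exact ⟨i, fun h => absurd h hi⟩
  choose p hp using h
  exact ⟨⟨Set.range y, {e | ∃ i : Fin n, 0 < (i : ℕ) ∧ e = s(y i, y (p i))}⟩, p, hp, rfl, rfl⟩

/-- The set is arbitrary because an uncomputable procedure may have a nonmeasurable miss event; a
measurable equivalence preserves the outer measure too. -/
lemma volume_preimage_comp_perm (π : Equiv.Perm (Fin n)) (A : Set (Fin n → Torus d)) :
    volume {y : Fin n → Torus d | y ∘ π ∈ A} = volume A := by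
  have h := volume_measurePreserving_piCongrLeft (fun _ : Fin n => Torus d) π.symm
  rw [← h.measure_preimage_equiv A]
  congr 1
  ext y
  have : MeasurableEquiv.piCongrLeft (fun _ : Fin n => Torus d) π.symm y = y ∘ π := by
    ext1 i
    obtain ⟨j, rfl⟩ := π.symm.surjective i
    rw [MeasurableEquiv.coe_piCongrLeft, Equiv.piCongrLeft_apply_apply]
    simp
  simp [this]

/-- Pigeonhole: on `E` the relabelings `π v` give one and the same tree `K + 1` distinct roots, so
`H T` omits the root of some relabeling. Hence `E` is almost surely covered by `K + 1` preimages of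
the miss event, each of the same measure. -/
lemma volume_le_mul_missEvent {K : ℕ} (hn : 0 < n) (H : Procedure d)
    (hK : ∀ᵐ x : Fin n → Torus d, ∀ T, IsNNTree x T → (H T).card ≤ K)
    (π : Fin (K + 1) → Equiv.Perm (Fin n)) (E : Set (Fin n → Torus d))
    (hinj : ∀ y ∈ E, Function.Injective fun v => y (π v ⟨0, hn⟩))
    (hT : ∀ y ∈ E, ∀ T, IsNNTree y T → ∀ v, IsNNTree (y ∘ π v) T) :
    volume E ≤ (K + 1 : ℕ) * volume (missEvent H n) := by
  classical
  have hsub : E ≤ᵐ[volume] ⋃ v, {y | y ∘ π v ∈ missEvent H n} := by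
    filter_upwards [hK] with y hy hyE
    obtain ⟨T, hyT⟩ := exists_isNNTree y
    obtain ⟨v, hv⟩ : ∃ v, y (π v ⟨0, hn⟩) ∉ H T := by
      by_contra! hcon
      have := Finset.card_le_card_of_injOn (s := Finset.univ) (t := H T)
        (fun v => y (π v ⟨0, hn⟩)) (fun v _ => hcon v) ((hinj y hyE).injOn)
      have := hy T hyT
      simp only [Finset.card_univ, Fintype.card_fin] at *
      omega
    refine Set.mem_iUnion.2 ⟨v, T, hT y hyE T hyT v, ?_⟩
    rintro ⟨i, hi, hmem⟩
    have : i = ⟨0, hn⟩ := Fin.ext hi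
    rw [this] at hmem
    exact hv hmem
  refine (measure_mono_ae hsub).trans ((measure_iUnion_fintype_le _ _).trans ?_)
  simp_rw [volume_preimage_comp_perm]
  simp

/-- The position of the vertex that arrives at time `t`, when the positions `0, …, k - 1` are filled
upwards from `v` and then downwards from `v`. -/
def fillOrder (k v t : ℕ) : ℕ := if t + v < k then v + t else if t < k then k - 1 - t else t

/-- The arrival time of the neighbour to which the vertex arriving at time `t` is joined. -/
def fillParent (k v t : ℕ) : ℕ := if t + v = k then 0 else t - 1

lemma exists_fillPerm {k v : ℕ} (hk : k ≤ n) (hv : v < k) :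
    ∃ π : Equiv.Perm (Fin n), ∀ t, ((π t : Fin n) : ℕ) = fillOrder k v t := by
  have hlt : ∀ t < n, fillOrder k v t < n := by
    intro t ht
    unfold fillOrder
    split_ifs <;> omega
  let f : Fin n → Fin n := fun t => ⟨fillOrder k v t, hlt t t.2⟩
  have hf : Function.Injective f := by
    intro s t hst
    have h : fillOrder k v s = fillOrder k v t := congrArg Fin.val hst
    unfold fillOrder at h
    ext
    split_ifs at h <;> omega
  exact ⟨Equiv.ofBijective f (Finite.injective_iff_bijective.1 hf), fun t => rfl⟩

/-- Neighbouring positions among the first `k` are closer than positions that are not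
neighbouring. -/
def PathLike (k : ℕ) (y : Fin n → Torus d) : Prop :=
  ∀ a b c : Fin n, (a : ℕ) < k → (b : ℕ) < k → (c : ℕ) < k →
    ((a : ℕ) = b + 1 ∨ (b : ℕ) = a + 1) → c ≠ a → (a : ℕ) ≠ c + 1 → (c : ℕ) ≠ a + 1 →
    torusDist (y a) (y b) < torusDist (y a) (y c)

/-- In the new order a path vertex arrives when exactly one of its neighbouring positions is
occupied, and that neighbour is closer than any other occupied position. Vertices from `k` on see
the same set of earlier points as before, so their parents do not change. -/
lemma PathLike.isNNTree_comp {k v : ℕ} {y : Fin n → Torus d} (hy : PathLike k y) (hk : k ≤ n) (hv : v < k)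
    {π : Equiv.Perm (Fin n)} (hπ : ∀ t, ((π t : Fin n) : ℕ) = fillOrder k v t)
    {T : EmbeddedTree (Torus d)} (hT : IsNNTree y T) : IsNNTree (y ∘ π) T := by
  obtain ⟨p, hp, hV, hE⟩ := hT
  -- In the original order the position `i - 1` is the only neighbour of `i` present, and any other
  -- choice is strictly farther.
  have hpk : ∀ i : Fin n, 0 < (i : ℕ) → (i : ℕ) < k → ((p i : Fin n) : ℕ) = i - 1 := by
    intro i hi hik
    obtain ⟨h1, h2⟩ := hp i hi
    have h1' : ((p i : Fin n) : ℕ) < i := h1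
    by_contra hne
    have h3 := h2 ⟨i - 1, by omega⟩ (by rw [Fin.lt_def]; simp only; omega)
    refine absurd h3 (not_le.2 (hy i ⟨i - 1, by omega⟩ (p i) hik ?_ ?_ ?_ h1.ne ?_ ?_)) <;>
      first | omega | (simp only; omega)
  have hlow : ∀ t : Fin n, (t : ℕ) < k → ((π t : Fin n) : ℕ) < k := by
    intro t ht
    rw [hπ]
    unfold fillOrder
    split_ifs <;> omega
  have hhigh : ∀ t : Fin n, k ≤ (t : ℕ) → π t = t := by
    intro t ht
    ext
    rw [hπ]
    unfold fillOrder
    split_ifs <;> omega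
  have hlt : ∀ s t : Fin n, k ≤ (t : ℕ) → (π s < t ↔ s < t) := by
    intro s t ht
    rcases lt_or_ge (s : ℕ) k with hs | hs
    · have := hlow s hs
      constructor <;> intro _ <;> rw [Fin.lt_def] <;> omega
    · rw [hhigh s hs]
  -- On the path the parent is the vertex that arrived just before, except that the first vertex of
  -- the downward phase is joined to the starting position, of time 0.
  let p' : Fin n → Fin n := fun t =>
    if (t : ℕ) < k then ⟨fillParent k v t, by unfold fillParent; split_ifs <;> omega⟩
    else π.symm (p t)
  have hp'k : ∀ t : Fin n, (t : ℕ) < k → ((p' t : Fin n) : ℕ) = fillParent k v t := by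
    intro t ht
    simp only [p', if_pos ht]
  have hp'h : ∀ t : Fin n, k ≤ (t : ℕ) → π (p' t) = p t := by
    intro t ht
    simp only [p', if_neg (not_lt.2 ht), Equiv.apply_symm_apply]
  have hadj : ∀ t : Fin n, 0 < (t : ℕ) → (t : ℕ) < k →
      ((t : ℕ) + v < k → ((π (p' t) : Fin n) : ℕ) + 1 = π t) ∧
      (k ≤ (t : ℕ) + v → ((π (p' t) : Fin n) : ℕ) = (π t : Fin n) + 1) := by
    intro t h0 ht
    rw [hπ, hπ, hp'k t ht]
    unfold fillParent fillOrder
    constructor <;> intro _ <;> split_ifs <;> omega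
  refine ⟨p', ?_, ?_, ?_⟩
  · intro t h0
    rcases lt_or_ge (t : ℕ) k with ht | ht
    · have hpt : p' t < t := by
        rw [Fin.lt_def, hp'k t ht]
        unfold fillParent
        split_ifs <;> omega
      refine ⟨hpt, fun s hs => ?_⟩
      have hs' : (s : ℕ) < t := hs
      by_cases hsp : s = p' t
      · rw [hsp]
      have hsp' : (s : ℕ) ≠ fillParent k v t := fun h => hsp (Fin.ext (h.trans (hp'k t ht).symm))
      have hpl : ((p' t : Fin n) : ℕ) < k := lt_trans hpt ht
      have h1 := hadj t h0 ht
      refine (hy (π t) (π (p' t)) (π s) (hlow _ ht) (hlow _ hpl) (hlow _ (by omega))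
        ?_ ?_ ?_ ?_).le
      · rcases lt_or_ge ((t : ℕ) + v) k with h | h
        · exact Or.inl (h1.1 h).symm
        · exact Or.inr (h1.2 h)
      · exact fun h => hs.ne (π.injective h)
      all_goals
        rw [hπ, hπ]
        unfold fillOrder
        unfold fillParent at hsp'
        split_ifs at hsp' ⊢ <;> omega
    · obtain ⟨h1, h2⟩ := hp t h0
      refine ⟨?_, fun s hs => ?_⟩
      · rw [← hlt _ _ ht, hp'h t ht]
        exact h1
      · simp only [Function.comp, hp'h t ht]
        rw [hhigh t ht]
        exact h2 _ ((hlt _ _ ht).2 hs)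
  · rw [hV, Set.range_comp, π.surjective.range_eq, Set.image_univ]
  · rw [hE]
    ext e
    simp only [Set.mem_ofPred_eq, Function.comp]
    constructor
    · rintro ⟨i, h0, rfl⟩
      rcases lt_or_ge (i : ℕ) k with hi | hi
      · have hpi := hpk i h0 hi
        -- The edge between the positions `i - 1` and `i` appears in the upward phase, with `i`
        -- arriving at time `i - v`, or in the downward phase, with `i - 1` arriving at time `k -
        -- i`.
        rcases lt_or_ge v (i : ℕ) with hvi | hvi
        · let t : Fin n := ⟨i - v, by omega⟩
          have ht : (t : ℕ) = i - v := rfl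
          have h1 : π t = i := by
            ext
            rw [hπ]
            unfold fillOrder
            split_ifs <;> omega
          refine ⟨t, by omega, ?_⟩
          have h2 : π (p' t) = p i := by
            ext
            have := (hadj t (by omega) (by omega)).1 (by omega)
            rw [h1] at this
            omega
          rw [h1, h2]
        · let t : Fin n := ⟨k - i, by omega⟩
          have ht : (t : ℕ) = k - i := rfl
          have h1 : π t = p i := by
            ext
            rw [hπ]
            unfold fillOrder
            split_ifs <;> omega
          refine ⟨t, by omega, ?_⟩
          have h2 : π (p' t) = i := by
            ext
            have := (hadj t (by omega) (by omega)).2 (by omega)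
            rw [h1] at this
            omega
          rw [h1, h2, Sym2.eq_swap]
      · exact ⟨i, h0, by rw [hp'h i hi, hhigh i hi]⟩
    · rintro ⟨t, h0, rfl⟩
      rcases lt_or_ge (t : ℕ) k with ht | ht
      · have h1 := hadj t h0 ht
        have hpl : ((p' t : Fin n) : ℕ) < k := by
          rw [hp'k t ht]
          unfold fillParent
          split_ifs <;> omega
        have h2 := hlow t ht
        have h3 := hlow _ hpl
        rcases lt_or_ge ((t : ℕ) + v) k with h | h
        · have h4 := h1.1 h
          refine ⟨π t, by omega, ?_⟩
          have : p (π t) = π (p' t) := by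
            ext
            rw [hpk _ (by omega) h2]
            omega
          rw [this]
        · have h4 := h1.2 h
          refine ⟨π (p' t), by omega, ?_⟩
          have : p (π (p' t)) = π t := by
            ext
            rw [hpk _ (by omega) h3]
            omega
          rw [this, Sym2.eq_swap]
      · exact ⟨t, h0, by rw [hp'h t ht, hhigh t ht]⟩

/-- The event `E` makes the first `K + 1` vertices equally likely to be the root. -/
lemma volume_le_mul_missEvent_of_pathLike {K : ℕ} (hn : K + 1 ≤ n) (H : Procedure d)
    (hK : ∀ᵐ x : Fin n → Torus d, ∀ T, IsNNTree x T → (H T).card ≤ K)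
    (E : Set (Fin n → Torus d)) (hE : ∀ y ∈ E, PathLike (K + 1) y)
    (hinj : ∀ y ∈ E, ∀ a b : Fin n, (a : ℕ) < K + 1 → (b : ℕ) < K + 1 → a ≠ b → y a ≠ y b) :
    volume E ≤ (K + 1 : ℕ) * volume (missEvent H n) := by
  choose π hπ using fun v : Fin (K + 1) => exists_fillPerm (n := n) hn v.2
  have h0 : ∀ v, ((π v ⟨0, by omega⟩ : Fin n) : ℕ) = v := by
    intro v
    rw [hπ]
    have := v.2
    unfold fillOrder
    split_ifs <;> simp only at * <;> omega
  refine volume_le_mul_missEvent (by omega) H hK π E ?_ ?_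
  · intro y hy v w hvw
    by_contra hne
    refine hinj y hy _ _ (by rw [h0]; exact v.2) (by rw [h0]; exact w.2) (fun h => hne ?_) hvw
    ext
    rw [← h0 v, h, h0 w]
  · intro y hy T hT v
    exact (hE y hy).isNNTree_comp hn v.2 (hπ v) hT

lemma successProb_le_of_le_volume {K : ℕ} {H : Procedure d} {E : Set (Fin n → Torus d)} {b : ℝ}
    (h : volume E ≤ (K + 1 : ℕ) * volume (missEvent H n)) (hb : ENNReal.ofReal b ≤ volume E) :
    successProb H n ≤ 1 - b / (K + 1) := by
  unfold successProb
  apply sub_le_sub_left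
  rw [div_le_iff₀ (by positivity), mul_comm]
  have h1 := hb.trans h
  rw [← ofReal_measureReal, ← ENNReal.ofReal_natCast, ← ENNReal.ofReal_mul (by positivity),
    ENNReal.ofReal_le_ofReal_iff (by positivity)] at h1
  exact_mod_cast h1

/-! ### Configurations that force failure -/

/-- The first `k` vertices are near equally spaced points of the diagonal. -/
def diagonalEvent (d n k : ℕ) : Set (Fin n → Torus d) :=
  {y | ∀ j ∈ Finset.univ.filter (fun j : Fin n => (j : ℕ) < k), ∀ c,
    ‖y j c - ((j / (4 * k) : ℝ) : UnitAddCircle)‖ ≤ 1 / (32 * k)}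

lemma volume_diagonalEvent {k : ℕ} (hk : 0 < k) (hkn : k ≤ n) :
    volume (diagonalEvent d n k) = ENNReal.ofReal ((1 / (16 * k)) ^ (d * k)) := by
  have h := volume_box (d := d) (fun (j : Fin n) _ => ((j / (4 * k) : ℝ) : UnitAddCircle))
    (Finset.univ.filter (fun j : Fin n => (j : ℕ) < k)) (1 / (32 * k))
  have hcard : (Finset.univ.filter (fun j : Fin n => (j : ℕ) < k)).card = k := by
    rw [← Finset.card_map Fin.valEmbedding]
    have : (Finset.univ.filter (fun j : Fin n => (j : ℕ) < k)).map Fin.valEmbedding =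
        Finset.range k := by
      ext a
      simp only [Finset.mem_map, Finset.mem_filter, Finset.mem_univ, true_and,
        Fin.valEmbedding_apply, Finset.mem_range]
      constructor
      · rintro ⟨i, hi, rfl⟩
        exact hi
      · intro ha
        exact ⟨⟨a, by omega⟩, ha, rfl⟩
    rw [this, Finset.card_range]
  have hk1 : (1 : ℝ) ≤ k := by exact_mod_cast hk
  have hmin : min 1 (2 * (1 / (32 * k : ℝ))) = 1 / (16 * k) := by
    rw [min_eq_right]
    · field_simp; norm_num
    · rw [← mul_div_assoc, mul_one, div_le_one (by positivity)]
      linarith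
  rw [hcard, hmin, ← ENNReal.ofReal_pow (by positivity)] at h
  exact h

/-- The ideal points span less than `1/4` of the circle in each coordinate, so there is no wrapping
around; the two perturbations add up to `2 / (32 k)`. -/
lemma norm_sub_of_mem_diagonalEvent {k : ℕ} {y : Fin n → Torus d} (hy : y ∈ diagonalEvent d n k)
    {a b : Fin n} (ha : (a : ℕ) < k) (hb : (b : ℕ) < k) (c : Fin d) :
    |‖y a c - y b c‖ - |(a : ℝ) - b| / (4 * k)| ≤ 1 / (16 * k) := by
  have hk : (0 : ℝ) < k := by exact_mod_cast (by omega : 0 < k)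
  have h1 := hy a (by simpa using ha) c
  have h2 := hy b (by simpa using hb) c
  have haR : (a : ℝ) < k := by exact_mod_cast ha
  have hbR : (b : ℝ) < k := by exact_mod_cast hb
  have ha0 : (0 : ℝ) ≤ a := Nat.cast_nonneg _
  have hb0 : (0 : ℝ) ≤ b := Nat.cast_nonneg _
  have h3 : ‖((a / (4 * k) : ℝ) : UnitAddCircle) - ((b / (4 * k) : ℝ) : UnitAddCircle)‖ =
      |(a : ℝ) - b| / (4 * k) := by
    rw [← AddCircle.coe_sub, ← sub_div]
    have e : |((a : ℝ) - b) / (4 * k)| = |(a : ℝ) - b| / (4 * k) := by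
      rw [abs_div, abs_of_pos (by positivity : (0 : ℝ) < 4 * k)]
    rw [norm_coe_eq_abs, e]
    rw [e, div_le_iff₀ (by positivity)]
    have : |(a : ℝ) - b| ≤ k := abs_le.2 ⟨by linarith, by linarith⟩
    linarith
  rw [← h3]
  refine (abs_norm_sub_norm_le _ _).trans ?_
  rw [show y a c - y b c - (((a / (4 * k) : ℝ) : UnitAddCircle) - ((b / (4 * k) : ℝ) :
    UnitAddCircle)) = (y a c - ((a / (4 * k) : ℝ) : UnitAddCircle)) -
      (y b c - ((b / (4 * k) : ℝ) : UnitAddCircle)) by abel]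
  refine (norm_sub_le _ _).trans ((add_le_add h1 h2).trans (le_of_eq ?_))
  field_simp
  norm_num

/-- All coordinates behave alike, so Euclidean distances compare as coordinate distances do, with a
common factor `√d`: neighbours are within `4/16 + 1/16`, other pairs at least `8/16 - 1/16` apart,
in units of `1/k`. -/
lemma pathLike_of_mem_diagonalEvent (hd : 0 < d) {k : ℕ} {y : Fin n → Torus d}
    (hy : y ∈ diagonalEvent d n k) : PathLike k y := by
  intro a b c ha hb hc hab hca h1 h2
  have hk : (0 : ℝ) < k := by exact_mod_cast (by omega : 0 < k)
  have hsd : 0 < √(d : ℝ) := Real.sqrt_pos.2 (by exact_mod_cast hd)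
  have hu : torusDist (y a) (y b) ≤ √d * (5 / (16 * k)) := by
    apply torusDist_le_of_norm_le (by positivity)
    intro i
    have h := (abs_le.1 (norm_sub_of_mem_diagonalEvent hy ha hb i)).2
    have e : |(a : ℝ) - b| = 1 := by
      rcases hab with h | h
      · rw [h]; simp
      · rw [h]; simp
    rw [e] at h
    have : (5 : ℝ) / (16 * k) = 1 / (4 * k) + 1 / (16 * k) := by field_simp; norm_num
    linarith
  have hl : √d * (7 / (16 * k)) ≤ torusDist (y a) (y c) := by
    apply le_torusDist_of_le_norm (by positivity)
    intro i
    have h := (abs_le.1 (norm_sub_of_mem_diagonalEvent hy ha hc i)).1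
    have e : 2 ≤ |(a : ℝ) - c| := by
      have hne : (c : ℕ) ≠ a := fun h => hca (Fin.ext h)
      rcases lt_or_gt_of_ne hne with h | h
      · have : (c : ℝ) + 2 ≤ a := by exact_mod_cast (by omega : (c : ℕ) + 2 ≤ a)
        exact le_trans (by linarith) (le_abs_self _)
      · have : (a : ℝ) + 2 ≤ c := by exact_mod_cast (by omega : (a : ℕ) + 2 ≤ c)
        exact le_trans (by linarith) (neg_le_abs _)
    have h3 : 2 / (4 * k : ℝ) ≤ |(a : ℝ) - c| / (4 * k) := by gcongr
    have : (7 : ℝ) / (16 * k) = 2 / (4 * k) - 1 / (16 * k) := by field_simp; norm_num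
    linarith
  refine hu.trans_lt (lt_of_lt_of_le ?_ hl)
  gcongr
  norm_num

lemma ne_of_mem_diagonalEvent (hd : 0 < d) {k : ℕ} {y : Fin n → Torus d}
    (hy : y ∈ diagonalEvent d n k) {a b : Fin n} (ha : (a : ℕ) < k) (hb : (b : ℕ) < k)
    (hab : a ≠ b) : y a ≠ y b := by
  intro heq
  have hk : (0 : ℝ) < k := by exact_mod_cast (by omega : 0 < k)
  have h := (abs_le.1 (norm_sub_of_mem_diagonalEvent hy ha hb ⟨0, hd⟩)).1
  rw [heq, sub_self, norm_zero] at h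
  have e : 1 ≤ |(a : ℝ) - b| := by
    have hne : (a : ℤ) - b ≠ 0 := fun h => hab (Fin.ext (by omega))
    exact_mod_cast Int.one_le_abs hne
  have h3 : 1 / (4 * k : ℝ) ≤ |(a : ℝ) - b| / (4 * k) := by gcongr
  have : (1 : ℝ) / (4 * k) = 4 * (1 / (16 * k)) := by field_simp; norm_num
  have : 0 < 1 / (16 * (k : ℝ)) := by positivity
  linarith

lemma successProb_le_of_card_le (hd : 0 < d) {K : ℕ} (hn : K + 1 ≤ n) {H : Procedure d}
    (hK : ∀ᵐ x : Fin n → Torus d, ∀ T, IsNNTree x T → (H T).card ≤ K) :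
    successProb H n ≤ 1 - (1 / (16 * (K + 1))) ^ (d * (K + 1)) / (K + 1) := by
  have h := volume_le_mul_missEvent_of_pathLike hn H hK (diagonalEvent d n (K + 1))
    (fun y hy => pathLike_of_mem_diagonalEvent hd hy)
    (fun y hy a b ha hb hab => ne_of_mem_diagonalEvent hd hy ha hb hab)
  refine successProb_le_of_le_volume h ?_
  rw [volume_diagonalEvent (by omega) hn]
  push_cast
  exact le_rfl

/-- For `K ≤ 1` the desired inequality can fail, so these values must be excluded by a failure
probability independent of `d`. Two points have distance less than `1/4` with probability at most
`(1/2)^d ≤ 1/2`; otherwise exchanging them costs the factor `1/2`. -/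
lemma successProb_le_of_card_le_one (hd : 2 ≤ d) (hn : 2 ≤ n) {H : Procedure d}
    (hK : ∀ᵐ x : Fin n → Torus d, ∀ T, IsNNTree x T → (H T).card ≤ 1) :
    successProb H n ≤ 3 / 4 := by
  let i : Fin n := ⟨0, by omega⟩
  let j : Fin n := ⟨1, by omega⟩
  have hij : i ≠ j := by simp [i, j]
  set E : Set (Fin n → Torus d) := {y | 1 / 4 ≤ torusDist (y i) (y j)} with hE
  have hdiag : ∀ y ∈ E, y i ≠ y j := by
    intro y hy h
    have : (1 : ℝ) / 4 ≤ torusDist (y i) (y j) := hy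
    rw [h, torusDist_self] at this
    norm_num at this
  have h := volume_le_mul_missEvent_of_pathLike (K := 1) hn H hK E
    -- Two positions leave no room for a third one that is not a neighbour, so the condition is
    -- vacuous.
    (fun y _ a b c ha hb hc hab hca h1 h2 => by
      exfalso
      have : (c : ℕ) ≠ a := fun h => hca (Fin.ext h)
      omega)
    (fun y hy a b ha hb hab => by
      have hab' : (a : ℕ) ≠ b := fun h => hab (Fin.ext h)
      have : (a = i ∧ b = j) ∨ (a = j ∧ b = i) := by
        simp only [Fin.ext_iff, i, j]
        omega
      rcases this with ⟨rfl, rfl⟩ | ⟨rfl, rfl⟩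
      · exact hdiag y hy
      · exact (hdiag y hy).symm)
  have hb : ENNReal.ofReal (1 / 2) ≤ volume E := by
    have h1 : (1 : ENNReal) ≤ volume E + volume Eᶜ := by
      rw [← measure_univ (μ := (volume : Measure (Fin n → Torus d))), ← Set.union_compl_self E]
      exact measure_union_le _ _
    have h2 : volume Eᶜ ≤ ENNReal.ofReal (1 / 2) := by
      have h3 := volume_near_le (d := d) hij (1 / 4)
      have h4 : Eᶜ = {y : Fin n → Torus d | torusDist (y i) (y j) < 1 / 4} := by
        ext y
        simp [hE]
      rw [h4]
      refine h3.trans ?_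
      rw [← ENNReal.ofReal_pow (by norm_num)]
      apply ENNReal.ofReal_le_ofReal
      calc (2 * (1 / 4) : ℝ) ^ d ≤ (2 * (1 / 4)) ^ 1 :=
            pow_le_pow_of_le_one (by norm_num) (by norm_num) (by omega)
        _ = _ := by norm_num
    have h5 : (1 : ENNReal) = ENNReal.ofReal (1 / 2) + ENNReal.ofReal (1 / 2) := by
      rw [← ENNReal.ofReal_add (by norm_num) (by norm_num)]
      norm_num
    rw [h5] at h1
    have h6 := h1.trans (add_le_add_right h2 _)
    exact (ENNReal.add_le_add_iff_right ENNReal.ofReal_ne_top).1 h6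
  have := successProb_le_of_le_volume h hb
  norm_num at this
  linarith

end Exchange

/-! ### From the failure probability to the bound on `K` -/

lemma successProb_nonneg {d : ℕ} (H : Procedure d) (n : ℕ) : 0 ≤ successProb H n := by
  unfold successProb
  rw [sub_nonneg]
  exact measureReal_le_one

lemma liminf_successProb_le {d : ℕ} {H : Procedure d} {b : ℝ}
    (h : ∀ᶠ n : ℕ in atTop, successProb H n ≤ b) :
    Filter.liminf (fun n : ℕ => successProb H n) Filter.atTop ≤ b :=
  -- The lower bound 0 ensures that the supremum defining the real `liminf` is over a nonempty set.
  Filter.liminf_le_of_frequently_le h.frequently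
    ⟨0, Filter.eventually_map.2 (Filter.Eventually.of_forall fun n => successProb_nonneg H n)⟩

/-- This is `log d ≤ d / e`. The constant matters: `2/5` is less than `(2/3) * log 2`, so for `K ≥
2` the factor `d^(-1/d)` takes away less than two thirds of `log K`. -/
lemma log_le_two_fifths_mul {d : ℝ} (hd : 0 < d) : Real.log d ≤ d * (2 / 5) := by
  have h1 := Real.log_le_sub_one_of_pos (x := d / Real.exp 1) (by positivity)
  rw [Real.log_div hd.ne' (Real.exp_pos _).ne', Real.log_exp] at h1
  have h2 : d / Real.exp 1 ≤ d * (2 / 5) := by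
    rw [div_le_iff₀ (Real.exp_pos _)]
    have := Real.exp_one_gt_d9
    nlinarith
  linarith

lemma lower_bound_of_failure_le {d K : ℕ} {ε : ℝ} (hd : 2 ≤ d) (hK : 2 ≤ K)
    (h : (1 / (16 * (K + 1))) ^ (d * (K + 1)) / (K + 1 : ℝ) ≤ ε) :
    1 / 100 * Real.log (1 / ε) / d < K * Real.log (K * (d : ℝ) ^ (-(1 / d : ℝ))) := by
  have hdR : (2 : ℝ) ≤ d := by exact_mod_cast hd
  have hKR : (2 : ℝ) ≤ K := by exact_mod_cast hK
  have hlog2 := Real.log_two_gt_d9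
  have hlK : Real.log 2 ≤ Real.log K := Real.log_le_log (by norm_num) hKR
  -- Here `32 = 2 ^ 5 ≤ K ^ 5`.
  have h32 : Real.log (32 * K) ≤ 6 * Real.log K := by
    rw [Real.log_mul (by norm_num) (by linarith), show (32 : ℝ) = 2 ^ 5 by norm_num, Real.log_pow]
    push_cast
    linarith
  have h1 : Real.log (16 * (K + 1)) ≤ 6 * Real.log K := by
    refine le_trans (Real.log_le_log (by positivity) ?_) h32
    linarith
  have h2 : Real.log (K + 1) ≤ 6 * Real.log K := by
    refine le_trans (Real.log_le_log (by positivity) ?_) h32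
    linarith
  have h3 : Real.log (1 / ε) ≤ d * (K + 1) * (6 * Real.log K) + 6 * Real.log K := by
    have h4 := Real.log_le_log (by positivity) h
    rw [Real.log_div (by positivity) (by positivity), Real.log_pow, one_div, Real.log_inv] at h4
    rw [one_div, Real.log_inv]
    push_cast at h4
    have : (d : ℝ) * (K + 1) * Real.log (16 * (K + 1)) ≤ d * (K + 1) * (6 * Real.log K) := by
      gcongr
    linarith
  have h5 : Real.log (K * (d : ℝ) ^ (-(1 / d : ℝ))) = Real.log K - Real.log d / d := by
    rw [Real.log_mul (by linarith) (by positivity), Real.log_rpow (by linarith)]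
    ring
  have h6 : Real.log d / d ≤ 2 / 5 := by
    rw [div_le_iff₀ (by linarith)]
    linarith [log_le_two_fifths_mul (show (0 : ℝ) < d by linarith)]
  rw [h5, div_lt_iff₀ (by linarith)]
  have h7 : Real.log K / 3 ≤ Real.log K - Real.log d / d := by linarith
  have h8 : (d : ℝ) * (K + 1) + 1 ≤ 2 * d * K := by nlinarith
  have hl0 : 0 < Real.log K := by linarith
  -- The factor 12 here and the factor 3 lost in `h7` give the constant `1/36`, which exceeds
  -- `1/100`.
  have h9 : Real.log (1 / ε) ≤ 12 * (d * K * Real.log K) := by nlinarith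
  have h10 : K * (Real.log K / 3) * d ≤ K * (Real.log K - Real.log d / d) * d := by gcongr
  have h11 : 0 < d * K * Real.log K := by positivity
  linarith

theorem lower_bound {d : ℕ} {ε : ℝ} {H : Procedure d} {K : ℕ} (hd : 2 ≤ d)
    (hε4 : ε < 1 / 4)
    (hK : ∀ᶠ n : ℕ in Filter.atTop, ∀ᵐ x : Fin n → Torus d, ∀ T, IsNNTree x T → (H T).card ≤ K)
    (hH : 1 - ε ≤ Filter.liminf (fun n : ℕ => successProb H n) Filter.atTop) :
    1 / 100 * Real.log (1 / ε) / d < K * Real.log (K * (d : ℝ) ^ (-(1 / d : ℝ))) := by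
  rcases le_or_gt K 1 with h1 | h1
  · exfalso
    have : Filter.liminf (fun n : ℕ => successProb H n) Filter.atTop ≤ 3 / 4 := by
      apply liminf_successProb_le
      filter_upwards [hK, eventually_ge_atTop 2] with n hn h2
      apply successProb_le_of_card_le_one hd h2
      filter_upwards [hn] with x hx T hT
      exact (hx T hT).trans h1
    linarith
  · apply lower_bound_of_failure_le hd h1
    have : Filter.liminf (fun n : ℕ => successProb H n) Filter.atTop ≤
        1 - (1 / (16 * (K + 1))) ^ (d * (K + 1)) / (K + 1) := by
      apply liminf_successProb_le
      filter_upwards [hK, eventually_ge_atTop (K + 1)] with n hn h2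
      exact successProb_le_of_card_le (by omega) h2 hn
    linarith

/-! ### Reasoning about programs -/

/-- Started in `s`, the program halts after at most `c` steps in a state that satisfies `Q`. -/
def Achieves (P : Program) (s : State) (c : ℕ) (Q : State → Prop) : Prop :=
  ∃ (t : ℕ) (s' : State), Runs P s t s' ∧ t ≤ c ∧ Q s'

lemma Achieves.mono {P : Program} {s : State} {c c' : ℕ} {Q Q' : State → Prop}
    (h : Achieves P s c Q) (hc : c ≤ c') (hQ : ∀ s', Q s' → Q' s') : Achieves P s c' Q' := by
  obtain ⟨t, s', h1, h2, h3⟩ := h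
  exact ⟨t, s', h1, h2.trans hc, hQ _ h3⟩

lemma Achieves.skip {s : State} {Q : State → Prop} (h : Q s) : Achieves .skip s 1 Q :=
  ⟨1, s, .skip s, le_rfl, h⟩

lemma Achieves.setNat {s : State} {a : ℕ} {i e : NExp} {Q : State → Prop}
    (h : Q (s.writeNat a (i.eval s) (e.eval s))) :
    Achieves (.setNat a i e) s (1 + i.cost + e.cost) Q :=
  ⟨_, _, .setNat s a i e, le_rfl, h⟩

lemma Achieves.setReal {s : State} {a : ℕ} {i : NExp} {e : RExp} {Q : State → Prop}
    (h : Q (s.writeReal a (i.eval s) (e.eval s))) :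
    Achieves (.setReal a i e) s (1 + i.cost + e.cost) Q :=
  ⟨_, _, .setReal s a i e, le_rfl, h⟩

lemma Achieves.seq {P P' : Program} {s : State} {c c' : ℕ} {R Q : State → Prop}
    (h : Achieves P s c R) (h' : ∀ s', R s' → Achieves P' s' c' Q) :
    Achieves (.seq P P') s (c + c') Q := by
  obtain ⟨t, s', h1, h2, h3⟩ := h
  obtain ⟨t', s'', h1', h2', h3'⟩ := h' s' h3
  exact ⟨_, _, .seq h1 h1', add_le_add h2 h2', h3'⟩

lemma Achieves.setNat_seq {P : Program} {s : State} {a c : ℕ} {i e : NExp} {Q : State → Prop}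
    (h : Achieves P (s.writeNat a (i.eval s) (e.eval s)) c Q) :
    Achieves (.seq (.setNat a i e) P) s (1 + i.cost + e.cost + c) Q :=
  (Achieves.setNat (Q := fun s' => s' = s.writeNat a (i.eval s) (e.eval s)) rfl).seq
    fun _ hs => hs ▸ h

lemma Achieves.setReal_seq {P : Program} {s : State} {a c : ℕ} {i : NExp} {e : RExp}
    {Q : State → Prop} (h : Achieves P (s.writeReal a (i.eval s) (e.eval s)) c Q) :
    Achieves (.seq (.setReal a i e) P) s (1 + i.cost + e.cost + c) Q :=
  (Achieves.setReal (Q := fun s' => s' = s.writeReal a (i.eval s) (e.eval s)) rfl).seq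
    fun _ hs => hs ▸ h

lemma Achieves.ite {b : BExp} {P P' : Program} {s : State} {c : ℕ} {Q : State → Prop}
    (h : b.Holds s → Achieves P s c Q) (h' : ¬ b.Holds s → Achieves P' s c Q) :
    Achieves (.ite b P P') s (1 + b.cost + c) Q := by
  by_cases hb : b.Holds s
  · obtain ⟨t, s', h1, h2, h3⟩ := h hb
    exact ⟨_, _, .iteTrue hb h1, by omega, h3⟩
  · obtain ⟨t, s', h1, h2, h3⟩ := h' hb
    exact ⟨_, _, .iteFalse hb h1, by omega, h3⟩

/-- The invariant is indexed by the number of completed rounds, and exactly `N` rounds are made,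
which yields termination and the cost together. -/
lemma Achieves.while {b : BExp} {P : Program} {s : State} {N c : ℕ} (Inv : ℕ → State → Prop)
    (h0 : Inv 0 s)
    (hbody : ∀ k < N, ∀ s, Inv k s → b.Holds s ∧ Achieves P s c (Inv (k + 1)))
    (hend : ∀ s, Inv N s → ¬ b.Holds s) :
    Achieves (.while b P) s (N * (c + b.cost + 1) + (b.cost + 1)) (Inv N) := by
  have key : ∀ r k, k + r = N → ∀ s, Inv k s →
      Achieves (.while b P) s (r * (c + b.cost + 1) + (b.cost + 1)) (Inv N) := by
    intro r
    induction r with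
    | zero =>
      intro k hk s hs
      obtain rfl : k = N := by omega
      exact ⟨_, s, .whileFalse (hend s hs), by omega, hs⟩
    | succ r ih =>
      intro k hk s hs
      obtain ⟨hb, t, s', h1, h2, h3⟩ := hbody k (by omega) s hs
      obtain ⟨t', s'', h1', h2', h3'⟩ := ih (k + 1) (by omega) s' h3
      refine ⟨_, _, .whileTrue hb h1 h1', ?_, h3'⟩
      rw [Nat.succ_mul]
      omega
  exact key N 0 (by omega) s h0

/-- Run `P` for the values `0, 1, …, B - 1` of the counter in the cell `0` of the array `a`. -/
def forLoop (a : ℕ) (B : NExp) (P : Program) : Program :=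
  .seq (.setNat a (.const 0) (.const 0))
    (.while (.natLt (.read a (.const 0)) B)
      (.seq P (.setNat a (.const 0) (.add (.read a (.const 0)) (.const 1)))))

lemma Achieves.forLoop {a : ℕ} {B : NExp} {P : Program} {s : State} {N c : ℕ}
    (Inv : ℕ → State → Prop) (h0 : Inv 0 (s.writeNat a 0 0))
    (hB : ∀ k s, Inv k s → B.eval s = N)
    (hbody : ∀ k < N, ∀ s, Inv k s → s.nat a 0 = k →
      Achieves P s c fun s' => s'.nat a 0 = k ∧ Inv (k + 1) (s'.writeNat a 0 (k + 1))) :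
    Achieves (forLoop a B P) s (N * (c + B.cost + 10) + (B.cost + 10)) (Inv N) := by
  have h := Achieves.while (b := .natLt (.read a (.const 0)) B)
    (P := .seq P (.setNat a (.const 0) (.add (.read a (.const 0)) (.const 1))))
    (s := s.writeNat a 0 0) (N := N) (c := c + 6) (fun k s => Inv k s ∧ s.nat a 0 = k)
    ⟨h0, by simp [State.writeNat]⟩ ?_ ?_
  · refine (Achieves.setNat_seq h).mono ?_ fun s' hs => hs.1
    simp only [NExp.cost, BExp.cost]
    have : N * (c + 6 + (1 + (1 + 1) + B.cost) + 1) = N * (c + B.cost + 10) := by ring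
    omega
  · rintro k hk s ⟨hs, hsk⟩
    refine ⟨?_, ?_⟩
    · simp only [BExp.Holds, NExp.eval, hsk, hB k s hs]
      exact hk
    · refine ((hbody k hk s hs hsk).seq (c' := 6) ?_).mono le_rfl fun _ h => h
      rintro s' ⟨h1, h2⟩
      apply Achieves.setNat
      simp only [NExp.eval, h1]
      exact ⟨h2, by simp [State.writeNat]⟩
  · rintro s ⟨hs, hsk⟩
    simp only [BExp.Holds, NExp.eval, hsk, hB N s hs]
    exact lt_irrefl N

/-- The two states agree outside the arrays of naturals in `A` and the arrays of reals in `B`. -/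
def Frame (A B : Finset ℕ) (s s' : State) : Prop :=
  (∀ a ∉ A, s'.nat a = s.nat a) ∧ ∀ b ∉ B, s'.real b = s.real b

lemma Frame.refl (A B : Finset ℕ) (s : State) : Frame A B s s :=
  ⟨fun _ _ => rfl, fun _ _ => rfl⟩

lemma Frame.mono {A B A' B' : Finset ℕ} {s s' : State} (h : Frame A B s s') (hA : A ⊆ A')
    (hB : B ⊆ B') : Frame A' B' s s' :=
  ⟨fun a ha => h.1 a fun h => ha (hA h), fun b hb => h.2 b fun h => hb (hB h)⟩

lemma Frame.trans {A B : Finset ℕ} {s s' s'' : State} (h : Frame A B s s')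
    (h' : Frame A B s' s'') : Frame A B s s'' :=
  ⟨fun a ha => (h'.1 a ha).trans (h.1 a ha), fun b hb => (h'.2 b hb).trans (h.2 b hb)⟩

lemma Frame.writeNat {A B : Finset ℕ} {s s' : State} (h : Frame A B s s') {a : ℕ} (ha : a ∈ A)
    (i v : ℕ) : Frame A B s (s'.writeNat a i v) := by
  refine ⟨fun b hb => ?_, h.2⟩
  rw [← h.1 b hb]
  exact Function.update_of_ne (by rintro rfl; exact hb ha) _ _

lemma Frame.writeReal {A B : Finset ℕ} {s s' : State} (h : Frame A B s s') {b : ℕ} (hb : b ∈ B)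
    (i : ℕ) (v : ℝ) : Frame A B s (s'.writeReal b i v) := by
  refine ⟨h.1, fun a ha => ?_⟩
  rw [← h.2 a ha]
  exact Function.update_of_ne (by rintro rfl; exact ha hb) _ _

lemma nat_writeNat (s : State) (a i v b j : ℕ) :
    (s.writeNat a i v).nat b j = if b = a ∧ j = i then v else s.nat b j := by
  by_cases h : b = a
  · subst h
    simp [State.writeNat, Function.update_apply]
  · simp [State.writeNat, h]

lemma real_writeNat (s : State) (a i v : ℕ) : (s.writeNat a i v).real = s.real := rfl

lemma nat_writeReal (s : State) (a i : ℕ) (v : ℝ) : (s.writeReal a i v).nat = s.nat := rfl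

lemma real_writeReal (s : State) (a i : ℕ) (v : ℝ) (b j : ℕ) :
    (s.writeReal a i v).real b j = if b = a ∧ j = i then v else s.real b j := by
  by_cases h : b = a
  · subst h
    simp [State.writeReal, Function.update_apply]
  · simp [State.writeReal, h]

/-! ### The program

Arrays of naturals: `3` the marks, `4` the marks of the current round, `5` the offsets of the
vertices in the array of coordinates, `6`, `7`, `8` the scale, its rounded square root and the square
of that, `9`, `10`, `11` counters. Arrays of reals: `2` the squared lengths of the edges, `3`
the multiple of `ε` in the computation of the scale, `4` the square of the radius, `5` a
difference of coordinates. -/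

/-- The number of vertices. -/
def vertCount : NExp := .read 0 (.const 0)

/-- The number of edges. -/
def edgeCount : NExp := .sub (.read 0 (.const 0)) (.const 1)

/-- The value of the counter `a`. -/
def cnt (a : ℕ) : NExp := .read a (.const 0)

/-- The difference of two coordinates, folded to the distance on the circle. -/
noncomputable def foldDiff (t : ℝ) : ℝ := min |t| (1 - |t|)

/-- Naturals can only be added and subtracted by the machine, so the multiples `i * d` needed for
addressing coordinates are tabulated by repeated addition. -/
def offsetProgram : Program :=
  .seq (.setNat 5 (.const 0) (.const 0))
    (forLoop 10 vertCount
      (.setNat 5 (.add (cnt 10) (.const 1)) (.add (.read 5 (cnt 10)) (.read 0 (.const 1)))))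

lemma achieves_offsetProgram (s : State) :
    Achieves offsetProgram s (30 * s.nat 0 0 + 30) fun s' => Frame {5, 10} ∅ s s' ∧
      ∀ i ≤ s.nat 0 0, s'.nat 5 i = i * s.nat 0 1 := by
  have h := Achieves.setNat_seq (s := s) (a := 5) (i := .const 0) (e := .const 0)
    (Achieves.forLoop (a := 10) (B := vertCount) (N := s.nat 0 0)
    (P := .setNat 5 (.add (cnt 10) (.const 1)) (.add (.read 5 (cnt 10)) (.read 0 (.const 1))))
    (s := s.writeNat 5 0 0) (c := 13)
    (fun k s' => Frame {5, 10} ∅ s s' ∧ ∀ i ≤ k, s'.nat 5 i = i * s.nat 0 1) ?_ ?_ ?_)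
  · refine h.mono ?_ fun _ h => h
    simp only [NExp.cost, vertCount]
    omega
  · refine ⟨((Frame.refl _ _ _).writeNat (by decide) _ _).writeNat (by decide) _ _, ?_⟩
    intro i hi
    obtain rfl : i = 0 := by omega
    simp [nat_writeNat]
  · rintro k s' ⟨hf, -⟩
    simp only [vertCount, NExp.eval, hf.1 0 (by decide)]
  · rintro k hk s' ⟨hf, hs⟩ hc
    refine (Achieves.setNat ?_).mono (by simp [NExp.cost, cnt]) fun _ h => h
    simp only [NExp.eval, cnt, hc]
    refine ⟨by simp [nat_writeNat, hc],
      (hf.writeNat (by decide) _ _).writeNat (by decide) _ _, ?_⟩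
    intro i hi
    simp only [nat_writeNat]
    rcases Nat.lt_or_ge k i with h | h
    · obtain rfl : i = k + 1 := by omega
      simp [hs k le_rfl, hf.1 0 (by decide), Nat.succ_mul]
    · rw [if_neg (by omega), if_neg (by omega)]
      exact hs i h

/-- The address of the current coordinate of the end in the array `a` of the current edge. -/
def coordAddress (a : ℕ) : NExp := .add (.read 5 (.read a (cnt 10))) (cnt 11)

def addCoordProgram : Program :=
  .seq (.setReal 5 (.const 0) (.sub (.read 1 (coordAddress 1)) (.read 1 (coordAddress 2))))
  (.seq (.ite (.realLt (.read 5 (.const 0)) (.const 0))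
    (.setReal 5 (.const 0) (.sub (.const 0) (.read 5 (.const 0)))) .skip)
  (.seq (.ite (.realLt (.const 1) (.add (.read 5 (.const 0)) (.read 5 (.const 0))))
    (.setReal 5 (.const 0) (.sub (.const 1) (.read 5 (.const 0)))) .skip)
  (.setReal 2 (cnt 10)
    (.add (.read 2 (cnt 10)) (.mul (.read 5 (.const 0)) (.read 5 (.const 0)))))))

/-- The difference of the `j`-th coordinates of the ends of the edge `e`. -/
noncomputable def coordDiff (s : State) (e j : ℕ) : ℝ :=
  s.real 1 (s.nat 5 (s.nat 1 e) + j) - s.real 1 (s.nat 5 (s.nat 2 e) + j)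

lemma achieves_addCoordProgram (s : State) :
    Achieves addCoordProgram s 60 fun s' => Frame ∅ {2, 5} s s' ∧
      ∀ e, s'.real 2 e = if e = s.nat 10 0
        then s.real 2 e + foldDiff (coordDiff s e (s.nat 11 0)) ^ 2 else s.real 2 e := by
  set t := coordDiff s (s.nat 10 0) (s.nat 11 0) with ht
  have hstep : Achieves addCoordProgram s 57 fun s' => Frame ∅ {2, 5} s s' ∧
      ∀ e, s'.real 2 e = if e = s.nat 10 0
        then s.real 2 e + foldDiff t ^ 2 else s.real 2 e := by
    refine (Achieves.setReal_seq (c := 38) ((Achieves.seq (c := 11) (c' := 27)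
      (R := fun s' => Frame ∅ {2, 5} s s' ∧ s'.real 2 = s.real 2 ∧ s'.real 5 0 = |t|) ?_ ?_).mono
      le_rfl fun _ h => h)).mono ?_ fun _ h => h
    · have hf : Frame ∅ {2, 5} s (s.writeReal 5 0 t) := (Frame.refl _ _ _).writeReal (by decide) _ _
      refine (Achieves.ite (c := 6) (fun hb => ?_) (fun hb => ?_)).mono
        (by simp [BExp.cost, RExp.cost, NExp.cost]) fun _ h => h
      · refine Achieves.setReal ⟨hf.writeReal (by decide) _ _, ?_, ?_⟩
        · ext e
          simp [real_writeReal]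
        · have hb' : t < 0 := by
            simpa [BExp.Holds, RExp.eval, NExp.eval, real_writeReal, coordAddress, cnt, ht,
              coordDiff] using hb
          rw [abs_of_neg hb']
          simp [RExp.eval, NExp.eval, real_writeReal, coordAddress, cnt, ht, coordDiff]
      · refine (Achieves.skip ⟨hf, ?_, ?_⟩).mono (by norm_num) fun _ h => h
        · ext e
          simp [real_writeReal]
        · have hb' : 0 ≤ t := by
            simpa [BExp.Holds, RExp.eval, NExp.eval, real_writeReal, coordAddress, cnt, ht,
              coordDiff] using hb
          rw [abs_of_nonneg hb']
          simp [RExp.eval, NExp.eval, real_writeReal, coordAddress, cnt, ht, coordDiff]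
    · rintro s1 ⟨hf1, h12, h15⟩
      refine (Achieves.seq (c := 14) (c' := 13) (R := fun s' => Frame ∅ {2, 5} s s' ∧
        s'.real 2 = s.real 2 ∧ s'.real 5 0 = foldDiff t) ?_ ?_).mono le_rfl fun _ h => h
      · refine (Achieves.ite (c := 6) (fun hb => ?_) (fun hb => ?_)).mono
          (by simp [BExp.cost, RExp.cost, NExp.cost]) fun _ h => h
        · refine (Achieves.setReal ⟨hf1.writeReal (by decide) _ _, ?_, ?_⟩).mono
            (by simp [RExp.cost, NExp.cost]) fun _ h => h
          · ext e
            simp [real_writeReal, h12]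
          · simp only [BExp.Holds, RExp.eval, NExp.eval, h15, Nat.cast_one] at hb
            simp only [RExp.eval, NExp.eval, h15, Nat.cast_one, real_writeReal, foldDiff]
            rw [min_eq_right (by linarith)]
            simp
        · refine (Achieves.skip ⟨hf1, h12, ?_⟩).mono (by norm_num) fun _ h => h
          simp only [BExp.Holds, RExp.eval, NExp.eval, h15, Nat.cast_one] at hb
          rw [h15, foldDiff, min_eq_left (by linarith)]
      · rintro s2 ⟨hf2, h22, h25⟩
        refine (Achieves.setReal ⟨hf2.writeReal (by decide) _ _, ?_⟩).mono
            (by simp [RExp.cost, NExp.cost, cnt]) fun _ h => h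
        intro e
        simp only [real_writeReal, RExp.eval, NExp.eval, cnt, h22, h25, hf2.1 10 (by decide),
          true_and]
        split_ifs with he
        · rw [he]; ring
        · rfl
    · simp [RExp.cost, NExp.cost, coordAddress, cnt]
  refine hstep.mono (by norm_num) fun s' h => ⟨h.1, fun e => ?_⟩
  rw [h.2 e]
  split_ifs with he
  · rw [he]
  · rfl

/-- Lengths are kept squared because the machine has no square root; all thresholds are squared
accordingly. -/
def lengthProgram : Program :=
  forLoop 10 edgeCount
    (.seq (.setReal 2 (cnt 10) (.const 0)) (forLoop 11 (.read 0 (.const 1)) addCoordProgram))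

lemma achieves_lengthProgram (s : State) :
    Achieves lengthProgram s (100 * (s.nat 0 0 * (s.nat 0 1 + 1)) + 100) fun s' =>
      Frame {10, 11} {2, 5} s s' ∧ ∀ e < s.nat 0 0 - 1,
        s'.real 2 e = ∑ j ∈ Finset.range (s.nat 0 1), foldDiff (coordDiff s e j) ^ 2 := by
  set D := s.nat 0 1 with hD
  have hdiff : ∀ s', Frame {10, 11} {2, 5} s s' → ∀ e j, coordDiff s' e j = coordDiff s e j := by
    intro s' hf e j
    simp only [coordDiff, hf.1 5 (by decide), hf.1 1 (by decide), hf.1 2 (by decide),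
      hf.2 1 (by decide)]
  have h := Achieves.forLoop (a := 10) (B := edgeCount) (N := s.nat 0 0 - 1)
    (P := .seq (.setReal 2 (cnt 10) (.const 0)) (forLoop 11 (.read 0 (.const 1)) addCoordProgram))
    (s := s) (c := 80 * (D + 1)) (fun k s' => Frame {10, 11} {2, 5} s s' ∧ ∀ e < k,
        s'.real 2 e = ∑ j ∈ Finset.range D, foldDiff (coordDiff s e j) ^ 2) ?_ ?_ ?_
  · refine h.mono ?_ fun _ h => h
    simp only [NExp.cost, edgeCount]
    calc _ ≤ s.nat 0 0 * (100 * (D + 1)) + 100 := by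
          gcongr <;> omega
      _ = _ := by ring
  · exact ⟨(Frame.refl _ _ _).writeNat (by decide) _ _, fun e he => absurd he (Nat.not_lt_zero e)⟩
  · rintro k s' ⟨hf, -⟩
    simp only [edgeCount, NExp.eval, hf.1 0 (by decide)]
  · rintro k hk s1 ⟨hf, hs⟩ hc
    have h2 := Achieves.forLoop (a := 11) (B := .read 0 (.const 1)) (N := D)
      (P := addCoordProgram) (s := s1.writeReal 2 k 0) (c := 60)
      (fun j s' => Frame {11} {2, 5} s1 s' ∧ ∀ e, s'.real 2 e = if e = k then
        ∑ j ∈ Finset.range j, foldDiff (coordDiff s e j) ^ 2 else s1.real 2 e) ?_ ?_ ?_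
    · refine (Achieves.setReal_seq (c := D * (60 + (NExp.read 0 (NExp.const 1)).cost + 10) +
        ((NExp.read 0 (NExp.const 1)).cost + 10)) ?_).mono ?_ fun _ h => h
      · simp only [NExp.eval, cnt, hc, RExp.eval, Nat.cast_zero]
        refine h2.mono le_rfl ?_
        rintro s' ⟨hf', hs'⟩
        refine ⟨by rw [hf'.1 10 (by decide), hc],
          (hf.trans (hf'.mono (by decide) (by decide))).writeNat (by decide) _ _, ?_⟩
        intro e he
        rw [real_writeNat, hs' e]
        split_ifs with h
        · rfl
        · exact hs e (by omega)
      · simp only [NExp.cost, RExp.cost, cnt]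
        omega
    · refine ⟨((Frame.refl _ _ _).writeReal (by decide) _ _).writeNat (by decide) _ _, ?_⟩
      intro e
      simp [real_writeNat, real_writeReal]
    · rintro j s' ⟨hf', -⟩
      simp only [NExp.eval, hf'.1 0 (by decide), hf.1 0 (by decide), hD]
    · rintro j hj s2 ⟨hf2, hs2⟩ hc2
      refine (achieves_addCoordProgram s2).mono le_rfl ?_
      rintro s3 ⟨hf3, hs3⟩
      refine ⟨by rw [hf3.1 11 (by decide), hc2],
        (hf2.trans (hf3.mono (by decide) (by decide))).writeNat (by decide) _ _, ?_⟩
      intro e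
      rw [real_writeNat, hs3 e, hf2.1 10 (by decide), hc, hs2 e, hc2,
        hdiff s2 (hf.trans (hf2.mono (by decide) (by decide)))]
      split_ifs with h
      · rw [Finset.sum_range_succ]
      · rfl

def scaleProgram : Program :=
  .seq (.setReal 3 (.const 0) (.read 0 (.const 0)))
  (.seq (.setNat 6 (.const 0) (.const 0))
  (.while (.realLt (.read 3 (.const 0)) (.const 1))
    (.seq (.setReal 3 (.const 0) (.add (.read 3 (.const 0)) (.read 3 (.const 0))))
    (.setNat 6 (.const 0) (.add (cnt 6) (.const 1))))))

lemma achieves_scaleProgram (s : State) {k : ℕ} (hk : IsScale (s.real 0 0) k) :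
    Achieves scaleProgram s (30 * k + 30) fun s' => Frame {6} {3} s s' ∧ s'.nat 6 0 = k := by
  have h := Achieves.while (b := .realLt (.read 3 (.const 0)) (.const 1)) (N := k)
    (P := .seq (.setReal 3 (.const 0) (.add (.read 3 (.const 0)) (.read 3 (.const 0))))
      (.setNat 6 (.const 0) (.add (cnt 6) (.const 1))))
    (s := (s.writeReal 3 0 (s.real 0 0)).writeNat 6 0 0) (c := 16)
    (fun i s' => Frame {6} {3} s s' ∧ s'.nat 6 0 = i ∧ s'.real 3 0 = 2 ^ i * s.real 0 0) ?_ ?_ ?_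
  · refine (Achieves.setReal_seq (Achieves.setNat_seq h)).mono ?_ fun s' h => ⟨h.1, h.2.1⟩
    simp only [NExp.cost, RExp.cost, BExp.cost]
    omega
  · refine ⟨((Frame.refl _ _ _).writeReal (by decide) _ _).writeNat (by decide) _ _, ?_, ?_⟩ <;>
      simp [nat_writeNat, real_writeNat, real_writeReal]
  · rintro i hi s' ⟨hf, h6, h3⟩
    refine ⟨?_, ?_⟩
    · simp only [BExp.Holds, RExp.eval, NExp.eval, h3, Nat.cast_one]
      exact hk.2 i hi
    · refine (Achieves.setReal_seq (Achieves.setNat ?_)).mono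
        (by simp [RExp.cost, NExp.cost, cnt]) fun _ h => h
      refine ⟨(hf.writeReal (by decide) _ _).writeNat (by decide) _ _, ?_, ?_⟩
      · simp [nat_writeNat, nat_writeReal, NExp.eval, cnt, h6]
      · simp only [real_writeNat, real_writeReal, RExp.eval, NExp.eval, h3, and_self, if_true]
        ring
  · rintro s' ⟨hf, h6, h3⟩
    simp only [BExp.Holds, RExp.eval, NExp.eval, h3, Nat.cast_one, not_lt]
    exact hk.1

/-- The square is updated by `(i + 1)² = i² + 2 i + 1`; the same loop produces `(1/4)^q`, the square
of the radius `(1/2)^q`. -/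
def sqrtProgram : Program :=
  .seq (.setNat 7 (.const 0) (.const 0))
  (.seq (.setNat 8 (.const 0) (.const 0))
  (.seq (.setReal 4 (.const 0) (.const 1))
  (.while (.natLt (cnt 8) (cnt 6))
    (.seq (.setNat 8 (.const 0) (.add (.add (cnt 8) (.add (cnt 7) (cnt 7))) (.const 1)))
    (.seq (.setNat 7 (.const 0) (.add (cnt 7) (.const 1)))
    (.setReal 4 (.const 0) (.div (.read 4 (.const 0)) (.const 4))))))))

lemma achieves_sqrtProgram (s : State) {q : ℕ} (hq : IsCeilSqrt (s.nat 6 0) q) :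
    Achieves sqrtProgram s (50 * q + 50) fun s' => Frame {7, 8} {4} s s' ∧ s'.nat 7 0 = q ∧
      s'.real 4 0 = (1 / 4) ^ q := by
  have h := Achieves.while (b := .natLt (cnt 8) (cnt 6)) (N := q)
    (P := .seq (.setNat 8 (.const 0) (.add (.add (cnt 8) (.add (cnt 7) (cnt 7))) (.const 1)))
      (.seq (.setNat 7 (.const 0) (.add (cnt 7) (.const 1)))
      (.setReal 4 (.const 0) (.div (.read 4 (.const 0)) (.const 4)))))
    (s := ((s.writeNat 7 0 0).writeNat 8 0 0).writeReal 4 0 ((1 : ℕ) : ℝ)) (c := 30)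
    (fun i s' => Frame {7, 8} {4} s s' ∧ s'.nat 7 0 = i ∧ s'.real 4 0 = (1 / 4) ^ i ∧
      s'.nat 8 0 = i ^ 2) ?_ ?_ ?_
  · refine (Achieves.setNat_seq (Achieves.setNat_seq (Achieves.setReal_seq h))).mono ?_
      fun s' h => ⟨h.1, h.2.1, h.2.2.1⟩
    simp only [NExp.cost, RExp.cost, BExp.cost, cnt]
    omega
  · refine ⟨(((Frame.refl _ _ _).writeNat (by decide) _ _).writeNat (by decide) _ _).writeReal
      (by decide) _ _, ?_, ?_, ?_⟩ <;>
      simp [nat_writeNat, real_writeReal, nat_writeReal]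
  · rintro i hi s' ⟨hf, h7, h4, h8⟩
    refine ⟨?_, ?_⟩
    · simp only [BExp.Holds, NExp.eval, cnt, h8, hf.1 6 (by decide)]
      exact hq.2 i hi
    · refine (Achieves.setNat_seq (Achieves.setNat_seq (Achieves.setReal ?_))).mono
        (by simp [RExp.cost, NExp.cost, cnt]) fun _ h => h
      refine ⟨((hf.writeNat (by decide) _ _).writeNat (by decide) _ _).writeReal
        (by decide) _ _, ?_, ?_, ?_⟩
      · simp [nat_writeNat, nat_writeReal, NExp.eval, cnt, h7]
      · simp only [real_writeNat, real_writeReal, RExp.eval, NExp.eval, h4, and_self, if_true]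
        push_cast
        ring
      · simp only [nat_writeNat, nat_writeReal, NExp.eval, cnt, h7, h8]
        norm_num
        ring
  · rintro s' ⟨hf, h7, h4, h8⟩
    simp only [BExp.Holds, NExp.eval, cnt, h8, hf.1 6 (by decide), not_lt]
    exact hq.1

/-- Mark in the array `a` both ends of the edges that pass the test `b`. -/
def markEdges (a : ℕ) (b : BExp) : Program :=
  forLoop 10 edgeCount
    (.ite b (.seq (.setNat a (.read 1 (cnt 10)) (.const 1)) (.setNat a (.read 2 (cnt 10)) (.const 1)))
      .skip)

/-- By `hp` the test is insensitive to the marks being written and to all but the current value of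
the counter, so the marked set does not depend on the order of the edges. -/
lemma achieves_markEdges {a : ℕ} (ha : a = 3 ∨ a = 4) {b : BExp} (s : State) (p : ℕ → Prop)
    (hp : ∀ s', Frame {a, 10} ∅ s s' → (b.Holds s' ↔ p (s'.nat 10 0))) :
    Achieves (markEdges a b) s (s.nat 0 0 * (b.cost + 40) + 40) fun s' => Frame {a, 10} ∅ s s' ∧
      ∀ v, s'.nat a v = 1 ↔ s.nat a v = 1 ∨
        ∃ e < s.nat 0 0 - 1, p e ∧ (s.nat 1 e = v ∨ s.nat 2 e = v) := by
  have ha0 : (0 : ℕ) ∉ ({a, 10} : Finset ℕ) := by rcases ha with rfl | rfl <;> decide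
  have ha1 : (1 : ℕ) ∉ ({a, 10} : Finset ℕ) := by rcases ha with rfl | rfl <;> decide
  have ha2 : (2 : ℕ) ∉ ({a, 10} : Finset ℕ) := by rcases ha with rfl | rfl <;> decide
  have haa : a ∈ ({a, 10} : Finset ℕ) := by simp
  have ha10 : 10 ∈ ({a, 10} : Finset ℕ) := by simp
  have hne : a ≠ 10 ∧ 10 ≠ a ∧ 1 ≠ a ∧ 2 ≠ a := by rcases ha with rfl | rfl <;> decide
  have h := Achieves.forLoop (a := 10) (B := edgeCount) (N := s.nat 0 0 - 1) (P := .ite b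
      (.seq (.setNat a (.read 1 (cnt 10)) (.const 1)) (.setNat a (.read 2 (cnt 10)) (.const 1)))
      .skip) (s := s) (c := b.cost + 13) (fun k s' => Frame {a, 10} ∅ s s' ∧
      ∀ v, s'.nat a v = 1 ↔ s.nat a v = 1 ∨
        ∃ e < k, p e ∧ (s.nat 1 e = v ∨ s.nat 2 e = v)) ?_ ?_ ?_
  · refine h.mono ?_ fun _ h => h
    simp only [NExp.cost, edgeCount]
    exact Nat.add_le_add (Nat.mul_le_mul (by omega) (by omega)) (by omega)
  · refine ⟨(Frame.refl _ _ _).writeNat ha10 _ _, fun v => ?_⟩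
    simp [nat_writeNat, hne.1]
  · rintro k s' ⟨hf, -⟩
    simp only [edgeCount, NExp.eval, hf.1 0 ha0]
  · rintro k hk s' ⟨hf, hs⟩ hc
    refine (Achieves.ite (c := 12) (fun hb => ?_) (fun hb => ?_)).mono (by omega) fun _ h => h
    · rw [hp s' hf, hc] at hb
      refine (Achieves.setNat_seq (Achieves.setNat ?_)).mono (by simp [NExp.cost, cnt]) fun _ h => h
      simp only [NExp.eval, cnt, nat_writeNat, hne.2.1, hne.2.2.2, hne.1, false_and,
        if_false, hc, hf.1 1 ha1, hf.1 2 ha2, true_and]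
      refine ⟨((hf.writeNat haa _ _).writeNat haa _ _).writeNat ha10 _ _, fun v => ?_⟩
      have hs' := hs v
      constructor
      · intro hv
        by_cases h2 : v = s.nat 2 k
        · exact Or.inr ⟨k, by omega, hb, Or.inr h2.symm⟩
        by_cases h1 : v = s.nat 1 k
        · exact Or.inr ⟨k, by omega, hb, Or.inl h1.symm⟩
        rw [if_neg h2, if_neg h1, hs'] at hv
        rcases hv with hv | ⟨e, he, hv⟩
        · exact Or.inl hv
        · exact Or.inr ⟨e, by omega, hv⟩
      · intro hv
        split_ifs with h2 h1
        · rfl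
        · rfl
        · rw [hs']
          rcases hv with hv | ⟨e, he, hpe, hv⟩
          · exact Or.inl hv
          · have : e ≠ k := by
              rintro rfl
              rcases hv with hv | hv
              · exact h1 hv.symm
              · exact h2 hv.symm
            exact Or.inr ⟨e, by omega, hpe, hv⟩
    · rw [hp s' hf, hc] at hb
      refine (Achieves.skip ?_).mono (by norm_num) fun _ h => h
      refine ⟨hc, hf.writeNat ha10 _ _, fun v => ?_⟩
      simp only [nat_writeNat, hne.1, false_and, if_false]
      rw [hs v]
      refine or_congr_right ⟨?_, ?_⟩
      · rintro ⟨e, he, hv⟩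
        exact ⟨e, by omega, hv⟩
      · rintro ⟨e, he, hpe, hv⟩
        have : e ≠ k := by
          rintro rfl
          exact hb hpe
        exact ⟨e, by omega, hpe, hv⟩

/-- Mark the vertices that pass the test `b`. -/
def markVerts (b : BExp) : Program :=
  forLoop 10 vertCount (.ite b (.setNat 3 (cnt 10) (.const 1)) .skip)

lemma achieves_markVerts {b : BExp} (s : State) (p : ℕ → Prop)
    (hp : ∀ s', Frame {3, 10} ∅ s s' → (b.Holds s' ↔ p (s'.nat 10 0))) :
    Achieves (markVerts b) s (s.nat 0 0 * (b.cost + 40) + 40) fun s' => Frame {3, 10} ∅ s s' ∧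
      ∀ v, s'.nat 3 v = 1 ↔ s.nat 3 v = 1 ∨ (v < s.nat 0 0 ∧ p v) := by
  have h := Achieves.forLoop (a := 10) (B := vertCount) (N := s.nat 0 0) (P := .ite b
      (.setNat 3 (cnt 10) (.const 1)) .skip) (s := s) (c := b.cost + 13)
      (fun k s' => Frame {3, 10} ∅ s s' ∧
      ∀ v, s'.nat 3 v = 1 ↔ s.nat 3 v = 1 ∨ (v < k ∧ p v)) ?_ ?_ ?_
  · refine h.mono ?_ fun _ h => h
    simp only [NExp.cost, vertCount]
    exact Nat.add_le_add (Nat.mul_le_mul (by omega) (by omega)) (by omega)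
  · refine ⟨(Frame.refl _ _ _).writeNat (by decide) _ _, fun v => ?_⟩
    simp [nat_writeNat]
  · rintro k s' ⟨hf, -⟩
    simp only [vertCount, NExp.eval, hf.1 0 (by decide)]
  · rintro k hk s' ⟨hf, hs⟩ hc
    refine (Achieves.ite (c := 12) (fun hb => ?_) (fun hb => ?_)).mono (by omega) fun _ h => h
    · rw [hp s' hf, hc] at hb
      refine (Achieves.setNat ?_).mono (by simp [NExp.cost, cnt]) fun _ h => h
      simp only [NExp.eval, cnt, hc]
      refine ⟨by simp [nat_writeNat, hc],
        (hf.writeNat (by decide) _ _).writeNat (by decide) _ _, fun v => ?_⟩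
      simp only [nat_writeNat]
      by_cases hv : v = k
      · subst hv
        simp [hb]
      · rw [if_neg (by omega), if_neg (by omega), hs v]
        have : v < k ↔ v < k + 1 := by omega
        rw [this]
    · rw [hp s' hf, hc] at hb
      refine (Achieves.skip ?_).mono (by norm_num) fun _ h => h
      refine ⟨hc, hf.writeNat (by decide) _ _, fun v => ?_⟩
      simp only [nat_writeNat]
      rw [if_neg (by omega), hs v]
      refine or_congr_right ⟨fun h => ⟨by omega, h.2⟩, fun h => ⟨?_, h.2⟩⟩
      have : v ≠ k := by
        rintro rfl
        exact hb h.2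
      omega

/-- One round: mark the ends of the edges of length at least `ε` with a marked end. -/
def roundProgram : Program :=
  .seq (markEdges 4 (.and (.not (.realLt (.read 2 (cnt 10))
      (.mul (.read 0 (.const 0)) (.read 0 (.const 0)))))
      (.not (.and (.not (.natEq (.read 3 (.read 1 (cnt 10))) (.const 1)))
        (.not (.natEq (.read 3 (.read 2 (cnt 10))) (.const 1)))))))
    (markVerts (.natEq (.read 4 (cnt 10)) (.const 1)))

/-- The marks after a round. -/
def roundMarks (s : State) (M : Set ℕ) : Set ℕ :=
  M ∪ {v | v < s.nat 0 0 ∧ ∃ e < s.nat 0 0 - 1,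
    (s.real 0 0 * s.real 0 0 ≤ s.real 2 e ∧ (s.nat 1 e ∈ M ∨ s.nat 2 e ∈ M)) ∧
      (s.nat 1 e = v ∨ s.nat 2 e = v)}

/-- New marks go to the array 4 first, so that none spreads further in the same round. That array is
never cleared; this is harmless because its marks on vertices are already in the array 3, which is
the invariant `h4`. -/
lemma achieves_roundProgram (s : State) (h4 : ∀ v < s.nat 0 0, s.nat 4 v = 1 → s.nat 3 v = 1) :
    Achieves roundProgram s (150 * s.nat 0 0 + 80) fun s' => Frame {3, 4, 10} ∅ s s' ∧
      (∀ v, s'.nat 3 v = 1 ↔ v ∈ roundMarks s {v | s.nat 3 v = 1}) ∧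
      ∀ v < s.nat 0 0, s'.nat 4 v = 1 → s'.nat 3 v = 1 := by
  refine (Achieves.seq (achieves_markEdges (Or.inr rfl) s
    (fun e => s.real 0 0 * s.real 0 0 ≤ s.real 2 e ∧
      (s.nat 3 (s.nat 1 e) = 1 ∨ s.nat 3 (s.nat 2 e) = 1)) ?_) (c' := 50 * s.nat 0 0 + 40)
      fun s1 h1 => (achieves_markVerts s1 (fun v => s1.nat 4 v = 1) ?_).mono ?_ ?_).mono ?_
      fun _ h => h
  · intro s' hf
    simp only [BExp.Holds, RExp.eval, NExp.eval, cnt, not_lt, hf.2 2 (by decide),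
      hf.2 0 (by decide), hf.1 1 (by decide), hf.1 2 (by decide), hf.1 3 (by decide)]
    tauto
  · intro s' hf
    simp only [BExp.Holds, NExp.eval, cnt, hf.1 4 (by decide)]
  · simp only [BExp.cost, NExp.cost, cnt, h1.1.1 0 (by decide)]
    omega
  · rintro s2 ⟨hf2, hs2⟩
    obtain ⟨hf1, hs1⟩ := h1
    refine ⟨(hf1.mono (by decide) (by decide)).trans (hf2.mono (by decide) (by decide)), ?_, ?_⟩
    · intro v
      rw [hs2 v, hs1 v, hf1.1 3 (by decide), hf1.1 0 (by decide)]
      simp only [roundMarks, Set.mem_union, Set.mem_ofPred_eq]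
      constructor
      · rintro (h | ⟨hv, h | h⟩)
        · exact Or.inl h
        · exact Or.inl (h4 v hv h)
        · exact Or.inr ⟨hv, h⟩
      · rintro (h | ⟨hv, h⟩)
        · exact Or.inl h
        · exact Or.inr ⟨hv, Or.inr h⟩
    · intro v hv h
      rw [hf2.1 4 (by decide)] at h
      rw [hs2 v, hf1.1 0 (by decide)]
      exact Or.inr ⟨hv, h⟩
  · simp only [BExp.cost, NExp.cost, RExp.cost, cnt]
    omega

lemma roundMarks_congr {s s' : State} {A : Finset ℕ} (hf : Frame A ∅ s s') (h0 : 0 ∉ A)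
    (h1 : 1 ∉ A) (h2 : 2 ∉ A) (M : Set ℕ) : roundMarks s' M = roundMarks s M := by
  simp only [roundMarks, hf.1 0 h0, hf.1 1 h1, hf.1 2 h2, hf.2 0 (by simp), hf.2 2 (by simp)]

def markProgram : Program :=
  -- With `m = q + 2`, the test `n < q + 3` is `n ≤ m`.
  .seq (markVerts (.natLt vertCount (.add (cnt 7) (.const 3))))
  (.seq (markEdges 3 (.not (.realLt (.read 2 (cnt 10)) (.read 4 (.const 0)))))
  (forLoop 9 (.add (cnt 7) (.const 2)) roundProgram))

/-- The marks before the first round. -/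
def seedMarks (s : State) : Set ℕ :=
  {v | v < s.nat 0 0 ∧ s.nat 0 0 < s.nat 7 0 + 3} ∪
    {v | ∃ e < s.nat 0 0 - 1, s.real 4 0 ≤ s.real 2 e ∧ (s.nat 1 e = v ∨ s.nat 2 e = v)}

lemma achieves_markProgram (s : State) (h3 : ∀ v, s.nat 3 v = 0) (h4 : ∀ v, s.nat 4 v = 0) :
    Achieves markProgram s (300 * ((s.nat 0 0 + 1) * (s.nat 7 0 + 3))) fun s' =>
      ∀ v, s'.nat 3 v = 1 ↔ v ∈ (roundMarks s)^[s.nat 7 0 + 2] (seedMarks s) := by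
  set n := s.nat 0 0 with hn
  set q := s.nat 7 0 with hq
  refine (Achieves.seq (R := fun s1 => Frame {3, 10} ∅ s s1 ∧
      ∀ v, s1.nat 3 v = 1 ↔ (v < n ∧ n < q + 3)) (c := n * 60 + 40)
      (c' := n * 60 + 40 + ((q + 2) * (150 * n + 100) + 20)) ?_ fun s1 h1 =>
    Achieves.seq (R := fun s2 => Frame {3, 10} ∅ s s2 ∧
      ∀ v, s2.nat 3 v = 1 ↔ v ∈ seedMarks s) ?_ fun s2 h2 => ?_).mono ?_ fun _ h => h
  · refine (achieves_markVerts s (fun _ => n < q + 3) ?_).mono ?_ fun s1 h => ⟨h.1, fun v => ?_⟩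
    · intro s' hf
      simp only [BExp.Holds, NExp.eval, cnt, vertCount, hf.1 0 (by decide), hf.1 7 (by decide),
        hn, hq]
    · simp only [BExp.cost, NExp.cost, cnt, vertCount]
      omega
    · rw [h.2 v, h3 v]
      simp [hn]
  · obtain ⟨hf1, hs1⟩ := h1
    refine (achieves_markEdges (Or.inl rfl) s1 (fun e => s.real 4 0 ≤ s.real 2 e) ?_).mono ?_
      fun s2 h => ⟨hf1.trans h.1, fun v => ?_⟩
    · intro s' hf
      simp only [BExp.Holds, NExp.eval, RExp.eval, cnt, hf.2 4 (by decide), hf.2 2 (by decide),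
        hf1.2 4 (by decide), hf1.2 2 (by decide), not_lt]
    · simp only [BExp.cost, NExp.cost, RExp.cost, cnt, hf1.1 0 (by decide), hn]
      omega
    · rw [h.2 v, hs1 v]
      simp only [seedMarks, hf1.1 0 (by decide), hf1.1 1 (by decide), hf1.1 2 (by decide)]
      rfl
  · obtain ⟨hf2, hs2⟩ := h2
    refine (Achieves.forLoop (N := q + 2) (c := 150 * n + 80) (fun k s' =>
      Frame {3, 4, 9, 10} ∅ s s' ∧
      (∀ v, s'.nat 3 v = 1 ↔ v ∈ (roundMarks s)^[k] (seedMarks s)) ∧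
      ∀ v < n, s'.nat 4 v = 1 → s'.nat 3 v = 1) ?_ ?_ ?_).mono ?_ fun s' h => h.2.1
    · refine ⟨(hf2.mono (by decide) (by decide)).writeNat (by decide) _ _, ?_, ?_⟩
      · intro v
        simpa [nat_writeNat] using hs2 v
      · intro v _ h
        simp [nat_writeNat, hf2.1 4 (by decide), h4 v] at h
    · rintro k s' ⟨hf, -⟩
      simp only [NExp.eval, cnt, hf.1 7 (by decide), hq]
    · rintro k hk s' ⟨hf, hm, hm4⟩ hc
      have h0 : s'.nat 0 0 = n := by rw [hf.1 0 (by decide)]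
      refine (achieves_roundProgram s' (by rwa [h0])).mono (by rw [h0]) ?_
      rintro s3 ⟨hf3, hm3, hm34⟩
      refine ⟨by rw [hf3.1 9 (by decide), hc],
        (hf.trans (hf3.mono (by decide) (by decide))).writeNat (by decide) _ _, ?_, ?_⟩
      · intro v
        have hset : {v | s'.nat 3 v = 1} = (roundMarks s)^[k] (seedMarks s) := Set.ext hm
        simp only [nat_writeNat]
        rw [if_neg (by omega), hm3 v, hset, roundMarks_congr hf (by decide) (by decide) (by decide),
          Function.iterate_succ_apply']
      · intro v hv
        simp only [nat_writeNat]
        rw [if_neg (by omega), if_neg (by omega)]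
        exact hm34 v (by rwa [h0])
    · simp only [NExp.cost, cnt]
      exact Nat.add_le_add (Nat.mul_le_mul le_rfl (by omega)) (by omega)
  · nlinarith

/-- The program that marks the candidates. -/
def candidateProgram : Program :=
  .seq offsetProgram (.seq lengthProgram (.seq scaleProgram (.seq sqrtProgram markProgram)))

/-! ### Correctness and running time of the program -/

section Correctness

variable {d n : ℕ} {T : EmbeddedTree (Torus d)}

lemma foldDiff_coord (a b : UnitAddCircle) : foldDiff (coord a - coord b) = ‖a - b‖ :=
  (norm_sub_eq_min a b).symm

lemma real_inputState (ε : ℝ) (L : Listing T n) (i : Fin n) (j : Fin d) :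
    (inputState ε L).real 1 (i * d + j) = coord (L.vert i j) := by
  have hlt : (i : ℕ) * d + j < n * d := by
    have : ((i : ℕ) + 1) * d ≤ n * d := Nat.mul_le_mul_right d i.2
    have := j.2
    rw [Nat.succ_mul] at *
    omega
  have h1 : Fin.divNat ⟨(i : ℕ) * d + j, hlt⟩ = i := by
    ext
    simp only [Fin.divNat]
    rw [mul_comm, Nat.mul_add_div j.pos, Nat.div_eq_of_lt j.2, add_zero]
  have h2 : Fin.modNat ⟨(i : ℕ) * d + j, hlt⟩ = j := by
    ext
    simp only [Fin.modNat]
    rw [mul_comm, Nat.mul_add_mod, Nat.mod_eq_of_lt j.2]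
  simp only [inputState, one_ne_zero, if_false, if_true, dif_pos hlt, h1, h2]

/-- The listed edges join exactly the pairs of vertices that are joined in the tree. -/
lemma Listing.mem_edges_iff (L : Listing T n) (u v : Torus d) :
    s(u, v) ∈ T.edges ↔ ∃ e, (L.vert (L.src e) = u ∧ L.vert (L.tgt e) = v) ∨
      (L.vert (L.src e) = v ∧ L.vert (L.tgt e) = u) := by
  rw [← L.range_edge, Set.mem_range]
  simp_rw [Sym2.eq_iff]

/-- The state `s` contains the listing and the squared lengths of its edges. -/
structure Encodes (L : Listing T n) (s : State) : Prop where
  count : s.nat 0 0 = n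
  src : ∀ e : Fin (n - 1), s.nat 1 e = L.src e
  tgt : ∀ e : Fin (n - 1), s.nat 2 e = L.tgt e
  length : ∀ e : Fin (n - 1), s.real 2 e = torusDist (L.vert (L.src e)) (L.vert (L.tgt e)) ^ 2

/-- A round marks both ends of a long edge with a marked end, whereas `expand` adds the opposite end
only; the other one was marked already. Injectivity of the listing translates equality of points
into equality of indices. -/
lemma Encodes.mem_roundMarks_iff {L : Listing T n} {s : State} (hs : Encodes L s)
    (hε : 0 < s.real 0 0) {M : Set ℕ} {S : Set (Torus d)}
    (hM : ∀ i : Fin n, (i : ℕ) ∈ M ↔ L.vert i ∈ S) (i : Fin n) :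
    (i : ℕ) ∈ roundMarks s M ↔ L.vert i ∈ expand T (s.real 0 0) S := by
  have hlen : ∀ e : Fin (n - 1), s.real 0 0 * s.real 0 0 ≤ s.real 2 e ↔
      s.real 0 0 ≤ torusDist (L.vert (L.src e)) (L.vert (L.tgt e)) := by
    intro e
    rw [hs.length, ← sq, sq_le_sq₀ hε.le (torusDist_nonneg _ _)]
  simp only [roundMarks, expand, Set.mem_union, Set.mem_ofPred_eq, hM i, hs.count, L.mem_edges_iff]
  constructor
  · rintro (h | ⟨-, e, he, ⟨hle, hor⟩, hi⟩)
    · exact Or.inl h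
    · lift e to Fin (n - 1) using he
      rw [hlen] at hle
      rw [hs.src, hs.tgt] at hi hor
      rw [hM, hM] at hor
      rcases hi with hi | hi
      · have hi' : L.src e = i := Fin.ext hi
        rw [hi'] at hle hor
        rcases hor with h | h
        · exact Or.inl h
        · exact Or.inr ⟨_, h, ⟨e, Or.inr ⟨by rw [hi'], rfl⟩⟩, by rwa [torusDist_comm]⟩
      · have hi' : L.tgt e = i := Fin.ext hi
        rw [hi'] at hle hor
        rcases hor with h | h
        · exact Or.inr ⟨_, h, ⟨e, Or.inl ⟨rfl, by rw [hi']⟩⟩, hle⟩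
        · exact Or.inl h
  · rintro (h | ⟨u, hu, ⟨e, he⟩, hle⟩)
    · exact Or.inl h
    · refine Or.inr ⟨i.2, e, e.2, ?_⟩
      rw [hlen, hs.src, hs.tgt, hM, hM]
      rcases he with ⟨h1, h2⟩ | ⟨h1, h2⟩
      · rw [h1, h2]
        exact ⟨⟨hle, Or.inl hu⟩, Or.inr (congrArg Fin.val (L.vert_injective h2))⟩
      · rw [h1, h2]
        exact ⟨⟨by rwa [torusDist_comm], Or.inr hu⟩,
          Or.inl (congrArg Fin.val (L.vert_injective h1))⟩

lemma Listing.ncard_verts (L : Listing T n) : T.verts.ncard = n := by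
  rw [← L.range_vert, ← Set.image_univ, Set.ncard_image_of_injective _ L.vert_injective]
  simp

lemma Encodes.mem_seedMarks_iff {L : Listing T n} {s : State} (hs : Encodes L s) {q : ℕ}
    (hq : s.nat 7 0 = q) (hr : s.real 4 0 = (1 / 4) ^ q) (i : Fin n) :
    (i : ℕ) ∈ seedMarks s ↔ L.vert i ∈ seeds T ((1 / 2) ^ q) (q + 2) := by
  have hlen : ∀ e : Fin (n - 1), s.real 4 0 ≤ s.real 2 e ↔
      (1 / 2) ^ q ≤ torusDist (L.vert (L.src e)) (L.vert (L.tgt e)) := by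
    intro e
    rw [hs.length, hr, show (1 / 4 : ℝ) = (1 / 2) ^ 2 by norm_num, ← pow_mul, mul_comm 2 q, pow_mul,
      sq_le_sq₀ (by positivity) (torusDist_nonneg _ _)]
  have hi : L.vert i ∈ T.verts := L.range_vert ▸ Set.mem_range_self i
  simp only [seedMarks, seeds, Set.mem_union, Set.mem_ofPred_eq, hs.count, hq, L.mem_edges_iff,
    L.ncard_verts, i.2, hi, true_and, and_true]
  refine or_congr (by omega) ⟨?_, ?_⟩
  · rintro ⟨e, he, hle, hi⟩
    lift e to Fin (n - 1) using he
    rw [hlen] at hle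
    rw [hs.src, hs.tgt] at hi
    rcases hi with hi | hi
    · have hi' : L.src e = i := Fin.ext hi
      rw [hi'] at hle
      exact ⟨_, ⟨e, Or.inr ⟨by rw [hi'], rfl⟩⟩, by rwa [torusDist_comm]⟩
    · have hi' : L.tgt e = i := Fin.ext hi
      rw [hi'] at hle
      exact ⟨_, ⟨e, Or.inl ⟨rfl, by rw [hi']⟩⟩, hle⟩
  · rintro ⟨u, ⟨e, he⟩, hle⟩
    refine ⟨e, e.2, ?_⟩
    rw [hlen, hs.src, hs.tgt]
    rcases he with ⟨h1, h2⟩ | ⟨h1, h2⟩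
    · rw [h1, h2]
      exact ⟨hle, Or.inr (congrArg Fin.val (L.vert_injective h2))⟩
    · rw [h1, h2]
      exact ⟨by rwa [torusDist_comm], Or.inl (congrArg Fin.val (L.vert_injective h1))⟩

lemma IsNNTree.achieves_candidateProgram {x : Fin n → Torus d} (hT : IsNNTree x T)
    (L : Listing T n) {ε : ℝ} (hε : 0 < ε) {k q : ℕ} (hk : IsScale ε k) (hq : IsCeilSqrt k q) :
    Achieves candidateProgram (inputState ε L) (2000 * ((n + 1) * (d + k + q + 2))) fun s' =>
      ∀ i : Fin n, s'.nat 3 i = 1 ↔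
        L.vert i ∈ candidateProcedure ε ((1 / 2) ^ q) (q + 2) T := by
  set s := inputState ε L with hs
  have hn : s.nat 0 0 = n := by simp [hs, inputState]
  have hd : s.nat 0 1 = d := by simp [hs, inputState]
  have hε0 : s.real 0 0 = ε := by simp [hs, inputState]
  have hsrc : ∀ e : Fin (n - 1), s.nat 1 e = L.src e := by
    intro e; simp [hs, inputState]
  have htgt : ∀ e : Fin (n - 1), s.nat 2 e = L.tgt e := by
    intro e; simp [hs, inputState]
  refine (Achieves.seq (achieves_offsetProgram s) (c' := 100 * (n * (d + 1)) + 100 +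
    (30 * k + 30 + (50 * q + 50 + 300 * ((n + 1) * (q + 3))))) fun s1 h1 =>
    Achieves.seq (R := fun s2 => Frame {5, 10, 11} {2, 5} s s2 ∧ ∀ e : Fin (n - 1),
      s2.real 2 e = torusDist (L.vert (L.src e)) (L.vert (L.tgt e)) ^ 2) ?_ fun s2 h2 =>
    Achieves.seq (R := fun s3 => Frame {6} {3} s2 s3 ∧ s3.nat 6 0 = k) ?_ fun s3 h3 =>
    Achieves.seq (R := fun s4 => Frame {7, 8} {4} s3 s4 ∧ s4.nat 7 0 = q ∧
      s4.real 4 0 = (1 / 4) ^ q) ?_ fun s4 h4 => ?_).mono ?_ fun _ h => h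
  · obtain ⟨hf1, ho⟩ := h1
    refine (achieves_lengthProgram s1).mono ?_ ?_
    · rw [hf1.1 0 (by decide), hn, hd]
    · rintro s2 ⟨hf2, hl⟩
      refine ⟨(hf1.mono (by decide) (by decide)).trans (hf2.mono (by decide) (by decide)),
        fun e => ?_⟩
      rw [hf1.1 0 (by decide), hn, hd] at hl
      rw [hl e e.2, torusDist_sq, ← Fin.sum_univ_eq_sum_range
        (fun j => foldDiff (coordDiff s1 e j) ^ 2) d]
      refine Finset.sum_congr rfl fun j _ => ?_
      rw [← foldDiff_coord]
      simp only [coordDiff, hf1.1 1 (by decide), hf1.1 2 (by decide), hf1.2 1 (by decide), hsrc,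
        htgt]
      rw [ho _ (by rw [hn]; exact (L.src e).2.le), ho _ (by rw [hn]; exact (L.tgt e).2.le), hd, hs,
        real_inputState, real_inputState]
  · have : s2.real 0 0 = ε := by rw [h2.1.2 0 (by decide), hε0]
    exact achieves_scaleProgram s2 (by rwa [this])
  · exact achieves_sqrtProgram s3 (by rwa [h3.2])
  · have hf : Frame {5, 6, 7, 8, 10, 11} {2, 3, 4, 5} s s4 :=
      ((h2.1.mono (by decide) (by decide)).trans (h3.1.mono (by decide) (by decide))).trans
        (h4.1.mono (by decide) (by decide))
    have h40 : s4.nat 0 0 = n := by rw [hf.1 0 (by decide), hn]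
    have hE : Encodes L s4 := by
      refine ⟨h40, fun e => ?_, fun e => ?_, fun e => ?_⟩
      · rw [hf.1 1 (by decide), hsrc]
      · rw [hf.1 2 (by decide), htgt]
      · rw [h4.1.2 2 (by decide), h3.1.2 2 (by decide), h2.2]
    have hε4 : s4.real 0 0 = ε := by rw [hf.2 0 (by decide), hε0]
    refine (achieves_markProgram s4 ?_ ?_).mono ?_ ?_
    · intro v
      rw [hf.1 3 (by decide)]
      simp [hs, inputState]
    · intro v
      rw [hf.1 4 (by decide)]
      simp [hs, inputState]
    · rw [h40, h4.2.1]
    · intro s5 h5 i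
      rw [h5, h4.2.1, ← Finset.mem_coe, hT.coe_candidateProcedure, candidates]
      -- The rounds of the program and the iterates of `expand` correspond step by step.
      have key : ∀ m, ∀ i : Fin n, (i : ℕ) ∈ (roundMarks s4)^[m] (seedMarks s4) ↔
          L.vert i ∈ (expand T ε)^[m] (seeds T ((1 / 2) ^ q) (q + 2)) := by
        intro m
        induction m with
        | zero => exact hE.mem_seedMarks_iff h4.2.1 h4.2.2
        | succ m ih =>
          intro i
          rw [Function.iterate_succ_apply', Function.iterate_succ_apply']
          have := hE.mem_roundMarks_iff (by rwa [hε4]) ih i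
          rwa [hε4] at this
      exact key _ i
  · rw [hn]
    have e1 : n * (d + 1) ≤ (n + 1) * (d + k + q + 2) := Nat.mul_le_mul (by omega) (by omega)
    have e2 : (n + 1) * (q + 3) ≤ 2 * ((n + 1) * (d + k + q + 2)) := by
      rw [mul_left_comm]
      exact Nat.mul_le_mul_left _ (by omega)
    have e3 : d + k + q + 2 ≤ (n + 1) * (d + k + q + 2) := Nat.le_mul_of_pos_left _ (by omega)
    have e4 : n ≤ n * (d + 1) := Nat.le_mul_of_pos_right _ (by omega)
    omega

end Correctness

theorem upper_bound {d : ℕ} (hd : 2 ≤ d) : ∃ ε₀ : ℝ, 0 < ε₀ ∧ ∀ ε : ℝ, 0 < ε → ε < ε₀ →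
    ∃ H : Procedure d, ∀ n : ℕ, 1 ≤ n →
      (∀ (x : Fin n → Torus d) (T : EmbeddedTree (Torus d)),
        Function.Injective x → IsNNTree x T →
          (H T : Set (Torus d)) ⊆ T.verts ∧
          ((H T).card : ℝ) ≤
            Real.exp (Real.log (1 / ε) / Real.log (Real.log (1 / ε))
              + d * Real.log (Real.log (1 / ε))) ∧
          ∀ L : Listing T n,
            ReturnsWithin candidateProgram ε L (H T)
              (4000 * ((n : ℝ) ^ 2
                + (n : ℝ) * (1 / ε) ^ (1 / Real.log (Real.log (1 / ε)) : ℝ)))) ∧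
      1 - ε ≤ successProb H n := by
  obtain ⟨ε₀, hε₀, h⟩ := exists_threshold d hd
  refine ⟨ε₀, hε₀, fun ε hε hlt => ?_⟩
  obtain ⟨k, hk⟩ := exists_isScale hε
  obtain ⟨q, hq⟩ := exists_isCeilSqrt k
  obtain ⟨h10, hsize, htime⟩ := h ε hε hlt k q hk hq
  refine ⟨candidateProcedure ε ((1 / 2) ^ q) (q + 2), fun n hn => ⟨fun x T hx hT => ⟨?_, ?_, ?_⟩,
    le_successProb hn hd hε hk hq h10⟩⟩
  · rw [hT.coe_candidateProcedure]
    exact hT.candidates_subset _ _ _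
  · refine le_trans ?_ hsize
    -- `d * 2 ^ q` cells of side `r / d`, with `r = (1/2)^q`, span the unit interval.
    have hM : (d : ℝ) ≤ ((d * 2 ^ q : ℕ) : ℝ) * (1 / 2) ^ q := by
      push_cast
      rw [mul_assoc, ← mul_pow]
      norm_num
    -- The number of dyadic scales comes from `d < 2 ^ d` and `1 ≤ 2 ^ k * ε`.
    have hJ : (d : ℝ) < ε * 2 ^ (d + k + 1) := by
      have h1 : (d : ℝ) < 2 ^ d := by exact_mod_cast Nat.lt_two_pow_self
      have h2 := hk.1
      have e : ε * 2 ^ (d + k + 1) = 2 ^ d * (2 ^ k * ε) * 2 := by ring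
      rw [e]
      have h3 : (0 : ℝ) < 2 ^ d := by positivity
      nlinarith
    have := hT.card_candidateProcedure_le hx (by omega) hε
      (show (0 : ℝ) < (1 / 2) ^ q by positivity) (q + 2) (d * 2 ^ q) (d + k + 1) hM hJ
    exact_mod_cast this
  · intro L
    obtain ⟨t, s, hrun, ht, hs⟩ := hT.achieves_candidateProgram L hε hk hq
    refine ⟨t, s, hrun, ?_, hs⟩
    have ht' : (t : ℝ) ≤ 2000 * ((n + 1) * (d + k + q + 2)) := by exact_mod_cast ht
    set X := (1 / ε) ^ (1 / Real.log (Real.log (1 / ε)) : ℝ)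
    have hn1 : (1 : ℝ) ≤ n := by exact_mod_cast hn
    -- With `n + 1 ≤ 2 n` the second term of the time bound already suffices; the `n ^ 2` is slack.
    have h1 : ((n : ℝ) + 1) * (d + k + q + 2) ≤ (n + n) * X := by gcongr
    have h2 : (0 : ℝ) ≤ (n : ℝ) ^ 2 := by positivity
    linarith

end RootFinding

theorem theorem2 :
    (∃ (P : RootFinding.Program) (C : ℝ), 0 < C ∧
      ∀ d : ℕ, 2 ≤ d → ∃ ε₀ : ℝ, 0 < ε₀ ∧ ∀ ε : ℝ, 0 < ε → ε < ε₀ →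
        ∃ H : RootFinding.Procedure d, ∀ n : ℕ, 1 ≤ n →
          (∀ (x : Fin n → RootFinding.Torus d) (T : RootFinding.EmbeddedTree (RootFinding.Torus d)),
            Function.Injective x → RootFinding.IsNNTree x T →
              (H T : Set (RootFinding.Torus d)) ⊆ T.verts ∧
              ((H T).card : ℝ) ≤
                Real.exp (Real.log (1 / ε) / Real.log (Real.log (1 / ε))
                  + d * Real.log (Real.log (1 / ε))) ∧
              ∀ L : RootFinding.Listing T n,
                RootFinding.ReturnsWithin P ε L (H T)
                  (C * ((n : ℝ) ^ 2
                    + (n : ℝ) * (1 / ε) ^ (1 / Real.log (Real.log (1 / ε)) : ℝ)))) ∧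
          1 - ε ≤ RootFinding.successProb H n) ∧
    (∃ c ε₁ : ℝ, 0 < c ∧ 0 < ε₁ ∧
      ∀ (d : ℕ) (ε : ℝ) (H : RootFinding.Procedure d) (K : ℕ),
        2 ≤ d → 0 < ε → ε < ε₁ →
        (∀ᶠ n : ℕ in Filter.atTop, ∀ᵐ x : Fin n → RootFinding.Torus d,
          ∀ T, RootFinding.IsNNTree x T → (H T).card ≤ K) →
        1 - ε ≤ Filter.liminf (fun n : ℕ => RootFinding.successProb H n) Filter.atTop →
        c * Real.log (1 / ε) / d < K * Real.log (K * (d : ℝ) ^ (-(1 / d : ℝ)))) := by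
  refine ⟨⟨RootFinding.candidateProgram, 4000, by norm_num, fun d hd => RootFinding.upper_bound hd⟩,
    1 / 100, 1 / 4, by norm_num, by norm_num, ?_⟩
  intro d ε H K hd _ hε4 hK hH
  exact RootFinding.lower_bound hd hε4 hK hH
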